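/- Let $\ell$ be an odd prime and let $K$ be a number field containing the $\ell$-th roots of unity. Let $L/K$ be a cyclic extension of degree $\ell$ which is locally cyclotomic: at every place $w\mid v$ the extension $L_w/K_v$ is contained in the cyclotomic $\mathbb Z_\ell$-extension of $K_v$. Assume the Leopoldt conjecture for $\ell$ in $L$: the map $\mathbb Z_\ell\otimes E_L\to\prod_{w\mid\ell}\varprojlim_n L_w^\times/L_w^{\times\ell^n}$ is injective, where $E_L$ is the group of units of $L$. Notation, for a number field $F$. Put $\mathcal R_F=\mathbb Z_\ell\otimes_{\mathbb Z}F^\times$, let $\mathcal D_F$ be the free $\mathbb Z_\ell$-module on the finite places of $F$, and let $\mathcal D'_F\subset\mathcal D_F$ be the submodule of divisors prime to $\ell$. Let $\mathcal R^{bp}_F$ be the module of the elements of $\mathcal R_F$ whose image in $\varprojlim_n F_v^\times/F_v^{\times\ell^n}$ is a root of unity for every $v\mid\ell$, and let $\mathcal Cl^{bp}_F=\mathcal D'_F/\mathcal P^{bp}_F$, where $\mathcal P^{bp}_F$ is the module of the divisors of elements of $\mathcal R^{bp}_F$. Let $\operatorname{Log}$ be the Iwasawa logarithm on $\mathbb Q_\ell^\times$,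 with $\operatorname{Log}\ell=0$. The logarithmic valuation $\tilde v$ is the usual valuation if $v\nmid\ell$, and is $-\operatorname{Log}(N_{F_v/\mathbb Q_\ell}(\cdot))/\deg v$ if $v\mid\ell$. Here $\deg v$ is $\operatorname{Log}(Nv)$ if $v\nmid\ell$, and a generator of the $\mathbb Z_\ell$-module $\operatorname{Log}(N_{F_v/\mathbb Q_\ell}(F_v^\times))$ if $v\mid\ell$. Put $\widetilde{\operatorname{div}}(x)=\sum_v\tilde v(x)\,v$ for $x\in\mathcal R_F$. The logarithmic class group $\widetilde{\mathcal Cl}_F$ is the group of elements of degree $0$ of $\mathcal D_F$ modulo $\widetilde{\operatorname{div}}(\mathcal R_F)$, and the group of logarithmic units is $\widetilde{\mathcal E}_F=\ker\widetilde{\operatorname{div}}\subset\mathcal R_F$. For $\varepsilon\in\mathcal R_K$ one writes $K[\sqrt[\ell]{\varepsilon}]=K[\sqrt[\ell]{x}]$ for any $x\in K^\times$ with $x\equiv\varepsilon$ modulo $\mathcal R_K^\ell$. Let $\mathfrak a\in\mathcal D'_K$ represent a nontrivial class of $\mathcal Cl^{bp}_K$ which capitulates in $L$, i.e. the divisor $\mathfrak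 a_L$ of $L$ obtained from $\mathfrak a$ by extension is trivial in $\mathcal Cl^{bp}_L$. Then exactly one of the following holds: 1. (class type) $\mathfrak a$ has degree $0$ and represents a nontrivial class of $\widetilde{\mathcal Cl}_K$ which capitulates in $L$, i.e. $\mathfrak a_L$ has degree $0$ and its class in $\widetilde{\mathcal Cl}_L$ is trivial; 2. (unit type) $\mathfrak a$ is logarithmically principal, i.e. $\mathfrak a\in\widetilde{\operatorname{div}}(\mathcal R_K)$, and $L=K[\sqrt[\ell]{\varepsilon}]$ for some logarithmic unit $\varepsilon\in\widetilde{\mathcal E}_K$. Moreover, case 2 holds if and only if $L=K[\sqrt[\ell]{\varepsilon}]$ for some $\varepsilon\in\widetilde{\mathcal E}_K$. -/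

import Mathlib

namespace LogCap

noncomputable section

open IsDedekindDomain NumberField Filter Topology
open scoped TensorProduct

section PadicLog
variable (ℓ : ℕ) [Fact ℓ.Prime]

/-- The unit part `x ↦ x ℓ^(-v(x))` of a non-zero `ℓ`-adic number. -/
def unitPart : ℚ_[ℓ]ˣ →* ℤ_[ℓ]ˣ where
  toFun x := PadicInt.mkUnits (u := (x : ℚ_[ℓ]) * (ℓ : ℚ_[ℓ]) ^ (-(x : ℚ_[ℓ]).valuation)) (by
    have hp : (ℓ : ℝ) ≠ 0 := by exact_mod_cast (Fact.out : ℓ.Prime).ne_zero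
    rw [norm_mul, Padic.norm_p_zpow, Padic.norm_eq_zpow_neg_valuation x.ne_zero, ← zpow_add₀ hp]
    simp)
  map_one' := by
    apply Units.ext; apply Subtype.ext
    simp [PadicInt.mkUnits]
  map_mul' x y := by
    have hp : (ℓ : ℚ_[ℓ]) ≠ 0 := by exact_mod_cast (Fact.out : ℓ.Prime).ne_zero
    apply Units.ext; apply Subtype.ext
    change ((x * y : ℚ_[ℓ]ˣ) : ℚ_[ℓ]) * (ℓ : ℚ_[ℓ]) ^ (-((x * y : ℚ_[ℓ]ˣ) : ℚ_[ℓ]).valuation) =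
      ((x : ℚ_[ℓ]) * (ℓ : ℚ_[ℓ]) ^ (-(x : ℚ_[ℓ]).valuation)) *
        ((y : ℚ_[ℓ]) * (ℓ : ℚ_[ℓ]) ^ (-(y : ℚ_[ℓ]).valuation))
    rw [Units.val_mul, Padic.valuation_mul x.ne_zero y.ne_zero, neg_add, zpow_add₀ hp]
    ring

/-- The power `u ^ ((ℓ-1) ℓ^n)`. -/
def logPow (n : ℕ) : ℤ_[ℓ]ˣ →* ℤ_[ℓ] :=
  (Units.coeHom ℤ_[ℓ]).comp (powMonoidHom ((ℓ - 1) * ℓ ^ n))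

theorem logPow_dvd (n : ℕ) (u : ℤ_[ℓ]ˣ) : (ℓ : ℤ_[ℓ]) ^ (n + 1) ∣ logPow ℓ n u - 1 := by
  rw [← Ideal.mem_span_singleton, ← PadicInt.ker_toZModPow, RingHom.mem_ker, map_sub, map_one,
    sub_eq_zero]
  have h := ZMod.pow_totient (Units.map (PadicInt.toZModPow (p := ℓ) (n + 1)).toMonoidHom u)
  rw [Nat.totient_prime_pow_succ Fact.out, mul_comm] at h
  simpa [logPow] using congrArg Units.val h

/-- The approximation `(u ^ ((ℓ-1) ℓ^n) - 1) / ((ℓ-1) ℓ^n)` to the logarithm of `u`. -/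
def logApprox (n : ℕ) (u : ℤ_[ℓ]ˣ) : ℚ_[ℓ] :=
  ((logPow ℓ n u - 1 : ℤ_[ℓ]) : ℚ_[ℓ]) / (((ℓ : ℚ_[ℓ]) - 1) * (ℓ : ℚ_[ℓ]) ^ n)

theorem norm_prime_sub_one : ‖(ℓ : ℚ_[ℓ]) - 1‖ = 1 := by
  have h : ‖(ℓ : ℚ_[ℓ])‖ < 1 := Padic.norm_p_lt_one
  rw [sub_eq_add_neg, Padic.add_eq_max_of_ne (by rw [norm_neg, norm_one]; exact h.ne), norm_neg,
    norm_one, max_eq_right h.le]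

theorem norm_logDenom (n : ℕ) :
    ‖((ℓ : ℚ_[ℓ]) - 1) * (ℓ : ℚ_[ℓ]) ^ n‖ = ((ℓ : ℝ) ^ n)⁻¹ := by
  rw [norm_mul, norm_prime_sub_one, one_mul, norm_pow, Padic.norm_p, inv_pow]

theorem norm_logPow_sub_one_le (n : ℕ) (u : ℤ_[ℓ]ˣ) :
    ‖((logPow ℓ n u - 1 : ℤ_[ℓ]) : ℚ_[ℓ])‖ ≤ ((ℓ : ℝ) ^ (n + 1))⁻¹ := by
  obtain ⟨c, hc⟩ := logPow_dvd ℓ n u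
  rw [hc, PadicInt.coe_mul, norm_mul, PadicInt.coe_pow, PadicInt.coe_natCast, norm_pow,
    Padic.norm_p, inv_pow]
  exact mul_le_of_le_one_right (by positivity) c.2

theorem norm_logApprox_le (n : ℕ) (u : ℤ_[ℓ]ˣ) : ‖logApprox ℓ n u‖ ≤ 1 := by
  have hp : (1 : ℝ) < ℓ := by exact_mod_cast (Fact.out : ℓ.Prime).one_lt
  rw [logApprox, norm_div, norm_logDenom, div_inv_eq_mul]
  refine (mul_le_mul_of_nonneg_right (norm_logPow_sub_one_le ℓ n u) (by positivity)).trans ?_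
  rw [pow_succ, mul_inv, mul_right_comm, inv_mul_cancel₀ (by positivity), one_mul]
  exact inv_le_one_of_one_le₀ hp.le

theorem cauchySeq_logApprox (u : ℤ_[ℓ]ˣ) : CauchySeq fun n => logApprox ℓ n u := by
  have hp : (1 : ℝ) < ℓ := by exact_mod_cast (Fact.out : ℓ.Prime).one_lt
  have hp0 : (ℓ : ℚ_[ℓ]) ≠ 0 := by exact_mod_cast (Fact.out : ℓ.Prime).ne_zero
  have hp1 : (ℓ : ℚ_[ℓ]) - 1 ≠ 0 := by
    rw [← norm_pos_iff, norm_prime_sub_one]; exact one_pos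
  refine cauchySeq_of_le_geometric ((ℓ : ℝ)⁻¹) 1 (inv_lt_one_of_one_lt₀ hp) fun n => ?_
  obtain ⟨k, hk⟩ := Polynomial.powAddExpansion (1 : ℤ_[ℓ]) (logPow ℓ n u - 1) ℓ
  have hs : logPow ℓ (n + 1) u = (logPow ℓ n u) ^ ℓ := by
    simp [logPow, pow_succ, pow_mul]
  have hd : logApprox ℓ (n + 1) u - logApprox ℓ n u =
      (k : ℚ_[ℓ]) * (((logPow ℓ n u - 1 : ℤ_[ℓ]) : ℚ_[ℓ])) ^ 2 /
        (((ℓ : ℚ_[ℓ]) - 1) * (ℓ : ℚ_[ℓ]) ^ (n + 1)) := by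
    rw [add_sub_cancel, ← hs] at hk
    have hk' : logPow ℓ (n + 1) u - 1 = ℓ * (logPow ℓ n u - 1) + k * (logPow ℓ n u - 1) ^ 2 := by
      rw [hk]; simp; ring
    rw [logApprox, logApprox, hk']
    push_cast
    field_simp
    ring
  rw [dist_comm, dist_eq_norm, hd, norm_div, norm_logDenom, norm_mul, norm_pow, div_inv_eq_mul,
    one_mul]
  have h1 := norm_logPow_sub_one_le ℓ n u
  calc ‖(k : ℚ_[ℓ])‖ * ‖((logPow ℓ n u - 1 : ℤ_[ℓ]) : ℚ_[ℓ])‖ ^ 2 * (ℓ : ℝ) ^ (n + 1)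
      ≤ 1 * (((ℓ : ℝ) ^ (n + 1))⁻¹) ^ 2 * (ℓ : ℝ) ^ (n + 1) := by
        gcongr
        exact k.2
    _ = ((ℓ : ℝ)⁻¹) ^ (n + 1) := by
        have hX : ((ℓ : ℝ) ^ (n + 1)) ≠ 0 := by positivity
        rw [one_mul, inv_pow, inv_pow, pow_two, mul_inv, mul_assoc, inv_mul_cancel₀ hX, mul_one]
    _ ≤ ((ℓ : ℝ)⁻¹) ^ n :=
        pow_le_pow_of_le_one (by positivity) (inv_le_one_of_one_le₀ hp.le) (Nat.le_succ n)

theorem tendsto_logApprox (u : ℤ_[ℓ]ˣ) :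
    Tendsto (fun n => logApprox ℓ n u) atTop (𝓝 (limUnder atTop fun n => logApprox ℓ n u)) :=
  (cauchySeq_logApprox ℓ u).tendsto_limUnder

/-- The `ℓ`-adic logarithm of a unit `u` of `ℤ_ℓ`: the limit of
`(u ^ ((ℓ-1) ℓ^n) - 1) / ((ℓ-1) ℓ^n)`. On `1 + ℓ ℤ_ℓ` it is the usual logarithmic series. -/
def unitLog (u : ℤ_[ℓ]ˣ) : ℤ_[ℓ] :=
  ⟨limUnder atTop fun n => logApprox ℓ n u,
    le_of_tendsto (tendsto_logApprox ℓ u).norm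
      (Eventually.of_forall fun n => norm_logApprox_le ℓ n u)⟩

theorem unitLog_mul (u w : ℤ_[ℓ]ˣ) : unitLog ℓ (u * w) = unitLog ℓ u + unitLog ℓ w := by
  have hp : (1 : ℝ) < ℓ := by exact_mod_cast (Fact.out : ℓ.Prime).one_lt
  apply Subtype.ext
  change limUnder atTop (fun n => logApprox ℓ n (u * w)) =
    limUnder atTop (fun n => logApprox ℓ n u) + limUnder atTop (fun n => logApprox ℓ n w)
  refine tendsto_nhds_unique (tendsto_logApprox ℓ (u * w)) ?_
  have h0 : Tendsto (fun n => logApprox ℓ n u * ((logPow ℓ n w - 1 : ℤ_[ℓ]) : ℚ_[ℓ])) atTop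
      (𝓝 0) := by
    refine squeeze_zero_norm (a := fun n => ((ℓ : ℝ)⁻¹) ^ n) (fun n => ?_)
      (tendsto_pow_atTop_nhds_zero_of_lt_one (by positivity) (inv_lt_one_of_one_lt₀ hp))
    rw [norm_mul]
    calc _ ≤ 1 * ((ℓ : ℝ) ^ (n + 1))⁻¹ :=
          mul_le_mul (norm_logApprox_le ℓ n u) (norm_logPow_sub_one_le ℓ n w) (norm_nonneg _)
            zero_le_one
      _ = ((ℓ : ℝ)⁻¹) ^ (n + 1) := by rw [one_mul, inv_pow]
      _ ≤ ((ℓ : ℝ)⁻¹) ^ n :=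
        pow_le_pow_of_le_one (by positivity) (inv_le_one_of_one_le₀ hp.le) (Nat.le_succ n)
  have h := ((tendsto_logApprox ℓ u).add (tendsto_logApprox ℓ w)).add h0
  rw [add_zero] at h
  refine h.congr fun n => ?_
  simp only [logApprox, map_mul]
  push_cast
  ring

/-- The Iwasawa logarithm `Log : ℚ_ℓˣ → ℤ_ℓ`, normalised by `Log ℓ = 0`. -/
def iwasawaLog : Additive ℚ_[ℓ]ˣ →+ ℤ_[ℓ] :=
  AddMonoidHom.mk' (fun x => unitLog ℓ (unitPart ℓ x.toMul)) fun x y => by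
    rw [toMul_add, map_mul, unitLog_mul]

end PadicLog

section SubQuotient
variable {R M : Type*} [CommRing R] [AddCommGroup M] [Module R M]

/-- The quotient `N / (N ∩ P)` of a submodule `N` by a submodule `P` of the same module. -/
abbrev SubQuot (N P : Submodule R M) : Type _ := N ⧸ P.comap N.subtype

/-- The class in `N / (N ∩ P)` of an element of `N`. -/
def SubQuot.mk (N P : Submodule R M) (x : M) (hx : x ∈ N) : SubQuot N P :=
  Submodule.Quotient.mk ⟨x, hx⟩

theorem SubQuot.mk_eq_zero_iff (N P : Submodule R M) (x : M) (hx : x ∈ N) :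
    SubQuot.mk N P x hx = 0 ↔ x ∈ P := by
  simp [SubQuot.mk, Submodule.Quotient.mk_eq_zero]

end SubQuotient

section Divisors
variable (ℓ : ℕ) [Fact ℓ.Prime]

/-- The `ℓ`-adification `ℤ_ℓ ⊗ F^×` of the multiplicative group of a field. -/
abbrev AdicUnits (F : Type*) [Field F] : Type _ := ℤ_[ℓ] ⊗[ℤ] Additive Fˣ

/-- Functoriality of `F ↦ ℤ_ℓ ⊗ F^×`. -/
def AdicUnits.map {E F : Type*} [Field E] [Field F] (f : E →+* F) :
    AdicUnits ℓ E →ₗ[ℤ_[ℓ]] AdicUnits ℓ F :=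
  (Units.map f.toMonoidHom).toAdditive.toIntLinearMap.baseChange ℤ_[ℓ]

/-- The `ℓ`-adic compactification `lim F^× / F^{× ℓ^n}`, as the `ℓ`-adic completion of
`ℤ_ℓ ⊗ F^×` (whose quotient by `ℓ^n` is `F^× / F^{× ℓ^n}`). -/
abbrev ProAdicUnits (F : Type*) [Field F] : Type _ :=
  AdicCompletion (Ideal.span {(ℓ : ℤ_[ℓ])}) (AdicUnits ℓ F)

/-- The canonical map `ℤ_ℓ ⊗ F^× → lim F^× / F^{× ℓ^n}`. -/
abbrev toProAdic (F : Type*) [Field F] : AdicUnits ℓ F →ₗ[ℤ_[ℓ]] ProAdicUnits ℓ F :=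
  AdicCompletion.of (Ideal.span {(ℓ : ℤ_[ℓ])}) (AdicUnits ℓ F)

/-- The image of the roots of unity of `F` in `lim F^× / F^{× ℓ^n}`. -/
def rootsOfUnityProAdic (F : Type*) [Field F] : Submodule ℤ_[ℓ] (ProAdicUnits ℓ F) :=
  Submodule.span ℤ_[ℓ] {z | ∃ ζ : Fˣ, IsOfFinOrder ζ ∧ z = toProAdic ℓ F (1 ⊗ₜ Additive.ofMul ζ)}

variable (K : Type*) [Field K] [NumberField K]

/-- The finite place `v` divides `ℓ`. -/
def Above (v : HeightOneSpectrum (𝓞 K)) : Prop := (ℓ : 𝓞 K) ∈ v.asIdeal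

variable {K} in
/-- The `ℤ_ℓ`-linear extension to `ℤ_ℓ ⊗ K^×` of the normalised valuation `K^× → ℤ` at `v`. -/
def ord (v : HeightOneSpectrum (𝓞 K)) : AdicUnits ℓ K →ₗ[ℤ_[ℓ]] ℤ_[ℓ] :=
  LinearMap.liftBaseChange ℤ_[ℓ]
    ((-((Int.castAddHom ℤ_[ℓ]).comp
      (MonoidHom.toAdditiveLeft (v.valuationOfNeZero (K := K))))).toIntLinearMap)

variable {K} in
/-- The localization map `ℤ_ℓ ⊗ K^× → lim K_v^× / K_v^{× ℓ^n}`. -/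
def loc (v : HeightOneSpectrum (𝓞 K)) : AdicUnits ℓ K →ₗ[ℤ_[ℓ]] ProAdicUnits ℓ (v.adicCompletion K) :=
  (toProAdic ℓ (v.adicCompletion K)).comp (AdicUnits.map ℓ (algebraMap K (v.adicCompletion K)))

/-- The pseudo-infinitesimal elements of `ℤ_ℓ ⊗ K^×`: those which are locally roots of unity at
all places above `ℓ`. -/
def pseudoInf : Submodule ℤ_[ℓ] (AdicUnits ℓ K) :=
  ⨅ (v : HeightOneSpectrum (𝓞 K)) (_ : Above ℓ K v),
    (rootsOfUnityProAdic ℓ (v.adicCompletion K)).comap (loc ℓ v)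

/-- The free `ℤ_ℓ`-module on all finite places of `K`. -/
abbrev Divisor : Type _ := HeightOneSpectrum (𝓞 K) →₀ ℤ_[ℓ]

/-- The `ℤ_ℓ`-divisors prime to `ℓ`. -/
def primeToDiv : Submodule ℤ_[ℓ] (Divisor ℓ K) :=
  Finsupp.supported ℤ_[ℓ] ℤ_[ℓ] {v | ¬ Above ℓ K v}

/-- The principal divisors (prime to `ℓ`) generated by the pseudo-infinitesimal elements. -/
def pseudoInfPrincipal : Submodule ℤ_[ℓ] (Divisor ℓ K) where
  carrier := {a | ∃ x ∈ pseudoInf ℓ K, ∀ v, a v = ord ℓ v x}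
  zero_mem' := ⟨0, zero_mem _, fun v => by simp⟩
  add_mem' := by
    rintro a b ⟨x, hx, hax⟩ ⟨y, hy, hby⟩
    exact ⟨x + y, add_mem hx hy, fun v => by simp [hax v, hby v]⟩
  smul_mem' := by
    rintro c a ⟨x, hx, hax⟩
    exact ⟨c • x, Submodule.smul_mem _ c hx, fun v => by simp [hax v]⟩

/-- The module of pseudo-infinitesimal classes of `K`: divisors prime to `ℓ` modulo those of
pseudo-infinitesimal elements. -/
abbrev BPClass : Type _ := SubQuot (primeToDiv ℓ K) (pseudoInfPrincipal ℓ K)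

/-- The Leopoldt conjecture for `ℓ` in `K`: the semi-localization map from `ℤ_ℓ ⊗ E_K` to the
product over the places above `ℓ` is injective, `E_K` being the group of units of `K`. -/
def Leopoldt : Prop :=
  ∀ x : ℤ_[ℓ] ⊗[ℤ] Additive (𝓞 K)ˣ,
    (∀ v : HeightOneSpectrum (𝓞 K), Above ℓ K v →
      loc ℓ v ((Units.map (algebraMap (𝓞 K) K).toMonoidHom).toAdditive.toIntLinearMap.baseChange
        ℤ_[ℓ] x) = 0) → x = 0

end Divisors

section Extension
variable {A : Type*} [CommRing A] [IsDedekindDomain A]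
variable (F : Type*) [Field F] [Algebra A F] [IsFractionRing A F]
variable (L : Type*) [Field L] [NumberField L] [Algebra F L] [Algebra A (𝓞 L)] [Algebra A L]
  [IsScalarTower A F L] [IsScalarTower A (𝓞 L) L] [Module.IsTorsionFree A (𝓞 L)]

/-- The homomorphism of completions `F_v → L_w` extending `F → L`, when `w` lies over `v`. -/
def completionMap (v : HeightOneSpectrum A) (w : HeightOneSpectrum (𝓞 L))
    (h : w.asIdeal.LiesOver v.asIdeal) : v.adicCompletion F →+* w.adicCompletion L :=
  ((HeightOneSpectrum.adicCompletion.equiv L w).symm.toRingHom.comp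
    (UniformSpace.Completion.mapRingHom
      (algebraMap (WithVal (v.valuation F)) (WithVal (w.valuation L)))
      (HeightOneSpectrum.uniformContinuous_algebraMap_liesOver F L v w).continuous)).comp
    (HeightOneSpectrum.adicCompletion.equiv F v).toRingHom

end Extension

section LogVal
variable (ℓ : ℕ) [Fact ℓ.Prime] {K : Type*} [Field K] [NumberField K]

/-- The prime of `ℤ` below `ℓ`. -/
def ratPlace : HeightOneSpectrum ℤ :=
  Rat.HeightOneSpectrum.primesEquiv.symm ⟨ℓ, Fact.out⟩

theorem liesOver_ratPlace {K : Type*} [Field K] (v : HeightOneSpectrum (𝓞 K)) (hv : Above ℓ K v) :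
    v.asIdeal.LiesOver (ratPlace ℓ).asIdeal := by
  constructor
  refine (ratPlace ℓ).isMaximal.eq_of_le (Ideal.comap_ne_top _ v.isPrime.ne_top) ?_
  have h : (ratPlace ℓ).asIdeal = Ideal.span {(ℓ : ℤ)} := by
    change Ideal.map (Rat.IsIntegralClosure.intEquiv ℤ).symm (Ideal.span {(ℓ : ℤ)}) = _
    rw [Ideal.map_span, Set.image_singleton, map_natCast]
  rw [h, Ideal.span_le, Set.singleton_subset_iff]
  simpa [Above] using hv

/-- For `v` above `ℓ`, the structural homomorphism `ℚ_ℓ → K_v`. -/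
def padicToCompletion (v : HeightOneSpectrum (𝓞 K)) (hv : Above ℓ K v) :
    ℚ_[ℓ] →+* v.adicCompletion K :=
  (completionMap ℚ K (ratPlace ℓ) v (liesOver_ratPlace ℓ v hv)).comp
    (Padic.adicCompletionEquiv ℤ ⟨ℓ, Fact.out⟩ : ℚ_[ℓ] ≃A[ℚ] _).toRingEquiv.toRingHom

/-- For `v` above `ℓ`, the norm `N : K_v → ℚ_ℓ`. -/
def localNorm (v : HeightOneSpectrum (𝓞 K)) (hv : Above ℓ K v) : v.adicCompletion K →* ℚ_[ℓ] :=
  letI := (padicToCompletion ℓ v hv).toAlgebra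
  Algebra.norm ℚ_[ℓ]

/-- For `v` above `ℓ`, the `ℤ_ℓ`-linear extension to `ℤ_ℓ ⊗ K_v^×` of `x ↦ -Log (N x)`. -/
def localLog (v : HeightOneSpectrum (𝓞 K)) (hv : Above ℓ K v) :
    AdicUnits ℓ (v.adicCompletion K) →ₗ[ℤ_[ℓ]] ℤ_[ℓ] :=
  LinearMap.liftBaseChange ℤ_[ℓ]
    ((-((iwasawaLog ℓ).comp (Units.map (localNorm ℓ v hv)).toAdditive)).toIntLinearMap)

/-- A linear form `f` with values in `ℤ_ℓ`, divided by a generator of its image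
(and `0` if `f = 0`). -/
def normalizeForm {M : Type*} [AddCommGroup M] [Module ℤ_[ℓ] M] (f : M →ₗ[ℤ_[ℓ]] ℤ_[ℓ]) :
    M →ₗ[ℤ_[ℓ]] ℤ_[ℓ] :=
  open Classical in
  if hg : Submodule.IsPrincipal.generator (LinearMap.range f) = 0 then 0 else
    have h : ∀ x, ∃ c, f x = Submodule.IsPrincipal.generator (LinearMap.range f) * c := fun x =>
      (Submodule.IsPrincipal.mem_iff_generator_dvd _).1 (LinearMap.mem_range_self f x)
    { toFun := fun x => (h x).choose
      map_add' := fun x y => mul_left_cancel₀ hg (by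
        rw [mul_add, ← (h (x + y)).choose_spec, ← (h x).choose_spec, ← (h y).choose_spec, map_add])
      map_smul' := fun c x => mul_left_cancel₀ hg (by
        rw [← (h (c • x)).choose_spec, map_smul, RingHom.id_apply, smul_eq_mul, smul_eq_mul,
          mul_left_comm, ← (h x).choose_spec]) }

open Classical in
/-- The `ℓ`-adic degree of a finite place `v`: `Log (N v)` if `v` does not divide `ℓ`, a generator of
the `ℤ_ℓ`-module `Log (N (K_v^×))` if `v` divides `ℓ`. -/
def logDeg (v : HeightOneSpectrum (𝓞 K)) : ℤ_[ℓ] :=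
  if hv : Above ℓ K v then Submodule.IsPrincipal.generator (LinearMap.range (localLog ℓ v hv))
  else iwasawaLog ℓ (Additive.ofMul (Units.mk0 ((Ideal.absNorm v.asIdeal : ℕ) : ℚ_[ℓ]) (by
    rw [Nat.cast_ne_zero, Ne, Ideal.absNorm_eq_zero_iff]; exact v.ne_bot)))

open Classical in
/-- The logarithmic valuation at a finite place `v`: the usual valuation if `v` does not divide `ℓ`,
and `-Log (N_{K_v / ℚ_ℓ} x) / deg v` if `v` divides `ℓ`. -/
def logVal (v : HeightOneSpectrum (𝓞 K)) : AdicUnits ℓ K →ₗ[ℤ_[ℓ]] ℤ_[ℓ] :=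
  if hv : Above ℓ K v then
    (normalizeForm ℓ (localLog ℓ v hv)).comp
      (AdicUnits.map ℓ (algebraMap K (v.adicCompletion K)))
  else ord ℓ v

variable (K)

/-- The logarithmic units: the elements all of whose logarithmic valuations vanish. -/
def logUnits : Submodule ℤ_[ℓ] (AdicUnits ℓ K) :=
  ⨅ v : HeightOneSpectrum (𝓞 K), LinearMap.ker (logVal ℓ v)

/-- The degree map on logarithmic divisors. -/
def logDivDeg : Divisor ℓ K →ₗ[ℤ_[ℓ]] ℤ_[ℓ] :=
  Finsupp.linearCombination ℤ_[ℓ] (logDeg ℓ)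

/-- The principal logarithmic divisors `∑ v, logVal v x • v`. -/
def logPrincipal : Submodule ℤ_[ℓ] (Divisor ℓ K) where
  carrier := {a | ∃ x : AdicUnits ℓ K, ∀ v, a v = logVal ℓ v x}
  zero_mem' := ⟨0, fun v => by simp⟩
  add_mem' := by
    rintro a b ⟨x, hx⟩ ⟨y, hy⟩
    exact ⟨x + y, fun v => by simp [hx v, hy v]⟩
  smul_mem' := by
    rintro c a ⟨x, hx⟩
    exact ⟨c • x, fun v => by simp [hx v]⟩

/-- The group of logarithmic classes of `K`: logarithmic divisors of degree `0` modulo principal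
logarithmic divisors. -/
abbrev LogClass : Type _ := SubQuot (LinearMap.ker (logDivDeg ℓ K)) (logPrincipal ℓ K)

end LogVal

section Ext
variable (ℓ : ℕ) [Fact ℓ.Prime] (K L : Type*) [Field K] [NumberField K] [Field L] [NumberField L]
  [Algebra K L]

theorem finite_under_preimage (s : Set (HeightOneSpectrum (𝓞 K))) (hs : s.Finite) :
    ((HeightOneSpectrum.under (𝓞 K) : HeightOneSpectrum (𝓞 L) → _) ⁻¹' s).Finite := by
  refine hs.preimage' fun v _ => ?_
  have := v.isMaximal
  refine Set.Finite.of_finite_image (f := HeightOneSpectrum.asIdeal)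
    ((IsDedekindDomain.primesOver_finite v.asIdeal (𝓞 L)).subset ?_) ?_
  · rintro _ ⟨w, hw, rfl⟩
    refine ⟨w.isPrime, ⟨?_⟩⟩
    rw [← (show HeightOneSpectrum.under (𝓞 K) w = v from hw)]
    rfl
  · exact fun w _ w' _ h => HeightOneSpectrum.ext h

/-- Extension of divisors prime to `ℓ` from `K` to `L`: `v ↦ ∑_{w | v} e(w|v) w`. -/
def extDiv : primeToDiv ℓ K →ₗ[ℤ_[ℓ]] primeToDiv ℓ L where
  toFun a := ⟨Finsupp.ofSupportFinite
    (fun w => (Ideal.ramificationIdx' (w.under (𝓞 K)).asIdeal w.asIdeal : ℤ_[ℓ]) *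
      a.1 (w.under (𝓞 K)))
    ((finite_under_preimage K L a.1.support a.1.support.finite_toSet).subset fun w hw => by
      simp only [Function.mem_support, ne_eq, mul_eq_zero, not_or] at hw
      simpa using hw.2), by
    refine (Finsupp.mem_supported _ _).2 fun w hw hwl => ?_
    have ha : a.1 (w.under (𝓞 K)) = 0 := by
      by_contra hne
      refine (Finsupp.mem_supported _ _).1 a.2 (Finsupp.mem_support_iff.2 hne) ?_
      change algebraMap (𝓞 K) (𝓞 L) (ℓ : 𝓞 K) ∈ w.asIdeal
      rw [map_natCast]
      exact hwl
    exact Finsupp.mem_support_iff.1 hw (by simp [Finsupp.ofSupportFinite, ha])⟩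
  map_add' a b := by
    ext w
    simp [Finsupp.ofSupportFinite, mul_add]
  map_smul' c a := by
    ext w
    simp [Finsupp.ofSupportFinite, mul_left_comm]

end Ext

section LocCyc
variable (ℓ : ℕ)

/-- For odd `ℓ`, the cyclotomic `ℤ_ℓ`-extension of `ℚ` inside an algebraically closed field `Ω` of
characteristic `0`: the compositum of the subfields of `ℚ(μ_{ℓ^∞})` whose degree over `ℚ` is a
power of `ℓ`. -/
def ratCyclotomic (Ω : Type*) [Field Ω] [Algebra ℚ Ω] : IntermediateField ℚ Ω :=
  ⨆ (E : IntermediateField ℚ Ω)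
    (_ : E ≤ IntermediateField.adjoin ℚ {ζ : Ω | ∃ n : ℕ, ζ ^ ℓ ^ n = 1} ∧
      ∃ n : ℕ, Module.finrank ℚ E = ℓ ^ n), E

variable (K L : Type*) [Field K] [NumberField K] [Field L] [NumberField L] [Algebra K L]

/-- For odd `ℓ`, `L/K` is locally cyclotomic: for each place `w` of `L` over a place `v` of `K`, the
extension `L_w / K_v` is contained in the cyclotomic `ℤ_ℓ`-extension of `K_v`, i.e. in the
compositum of `K_v` and the cyclotomic `ℤ_ℓ`-extension of `ℚ` (at infinite places, where the latter
compositum is `K_v`, this means `L_w = K_v`). -/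
def LocallyCyclotomic : Prop :=
  IsUnramifiedAtInfinitePlaces K L ∧
  ∀ w : HeightOneSpectrum (𝓞 L), ∀ x : w.adicCompletion L,
    algebraMap (w.adicCompletion L) (AlgebraicClosure (w.adicCompletion L)) x ∈
      Subfield.closure
        (Set.range ((algebraMap (w.adicCompletion L) (AlgebraicClosure (w.adicCompletion L))).comp
          (completionMap K L (w.under (𝓞 K)) w ⟨rfl⟩)) ∪
        (ratCyclotomic ℓ (AlgebraicClosure (w.adicCompletion L)) :
          Set (AlgebraicClosure (w.adicCompletion L))))

variable [Fact ℓ.Prime]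

/-- `L = K[ε^{1/ℓ}]` for `ε` in `ℤ_ℓ ⊗ K^×`: as `K^× / K^{×ℓ}` is the quotient of `ℤ_ℓ ⊗ K^×` by
its `ℓ`-th powers, this means `L = K[x^{1/ℓ}]` for an `x` in `K^×` in the class of `ε` modulo
`ℓ`-th powers. -/
def IsKummerExt (ε : AdicUnits ℓ K) : Prop :=
  ∃ (x : Kˣ) (β : AdicUnits ℓ K), ε = 1 ⊗ₜ[ℤ] Additive.ofMul x + (ℓ : ℤ_[ℓ]) • β ∧
    ∃ y : L, y ^ ℓ = algebraMap K L x ∧ IntermediateField.adjoin K {y} = ⊤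

variable {K}

/-- Class type, for a divisor `a` of `K` prime to `ℓ`: `a` has degree `0` as a logarithmic divisor,
its logarithmic class is not trivial, and that class capitulates in `L`. -/
def ClassType (a : primeToDiv ℓ K) : Prop :=
  ∃ (hK : a.1 ∈ LinearMap.ker (logDivDeg ℓ K))
    (hL : (extDiv ℓ K L a).1 ∈ LinearMap.ker (logDivDeg ℓ L)),
    (SubQuot.mk _ _ a.1 hK : LogClass ℓ K) ≠ 0 ∧
    (SubQuot.mk _ _ (extDiv ℓ K L a).1 hL : LogClass ℓ L) = 0

/-- Unit type, for a divisor `a` of `K` prime to `ℓ`: `a` is logarithmically principal, and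
`L = K[ε^{1/ℓ}]` for a logarithmic unit `ε` of `K`. -/
def UnitType (a : primeToDiv ℓ K) : Prop :=
  a.1 ∈ logPrincipal ℓ K ∧ ∃ ε ∈ logUnits ℓ K, IsKummerExt ℓ K L ε

end LocCyc

end

end LogCap

/-!
Write `R_F = ℤ_ℓ ⊗ F^×`, let `a` be the given divisor of `K` and let `σ` generate `Gal(L/K)`. As `a`
capitulates, `a_L` is the divisor of some pseudo-infinitesimal `α` in `R_L`. The element `σ α - α`
has trivial divisor, hence is a global unit, and it is locally a root of unity above `ℓ`; by the
Leopoldt conjecture it is a root of unity `ζ` (`exists_rootOfUnity_of_capitulates`). If `ζ` were `1`,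
`α` would descend to `K` and `a` would be trivial already. As `ζ` has norm `1` and `ℓ` is odd, `ζ` is
an `ℓ`-th root of unity (`rootOfUnity_pow_eq_one`), and Kummer theory yields `y` in `L` with
`L = K(y)`, `y ^ ℓ = c` in `K`, and `α = y + γ` with `γ` in `R_K` (`exists_kummer_generator`; `R_L`
is written additively).

* Degree. The norm to `ℚ` of a pseudo-infinitesimal element has trivial Iwasawa logarithm
  (`normLog_eq_zero_of_mem_pseudoInf`), so by the product formula its divisor, if prime to `ℓ`, has
  degree `0`. This applies to `a_L`, and to `a` because `ℓ α = c + ℓ γ` comes from `K`.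
* Logarithmic divisors. The logarithmic valuations of `α` are its usual valuations away from `ℓ` and
  vanish above `ℓ`, so `a_L` is the logarithmic divisor of `α`. If `a` is not logarithmically
  principal, this is the class type.
* If `a` is the logarithmic divisor of `β`, then `α - β` has trivial logarithmic divisor, so that
  `ℓ (α - β) = c + ℓ (γ - β)` is a logarithmic unit of `K`, whose `ℓ`-th root generates `L`
  (`exists_logUnit_of_mem_logPrincipal`).
* Conversely, let `L` be generated by an `ℓ`-th root of a logarithmic unit of `K`, and let `η` in
  `R_L` be this root. Then `η` has trivial logarithmic divisor, and `σ (j η) - j η = ζ` for some `j`,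
  so that `α - j η` descends to an element of `R_K` of logarithmic divisor `a`
  (`mem_logPrincipal_of_isKummerExt`).

Local roots of unity are handled through `IsTorsionMod`: an element of `ℤ_ℓ ⊗ A` is torsion in the
`ℓ`-adic completion if and only if a positive multiple of it is infinitely `ℓ`-divisible. Together
with the flatness of `ℤ_ℓ` over `ℤ`, this avoids explicit computations in the completions.
The vanishing of the logarithm of the norm is obtained by weak approximation: an element of `K^×`
which is an `ℓ ^ n`-th power at all places above `ℓ` is a global `ℓ ^ n`-th power times an element
close to `1` at these places, and the norm of the latter is close to `1` in `ℚ_ℓ`.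
-/

namespace LogCap
noncomputable section
open IsDedekindDomain NumberField Filter Topology
open scoped TensorProduct

/-! ### The functor `A ↦ ℤ_ℓ ⊗ A` on abelian groups -/

section AdicTensor
variable (ℓ : ℕ) [Fact ℓ.Prime] {A B C : Type*} [AddCommGroup A] [AddCommGroup B] [AddCommGroup C]

theorem exists_int_add_pow_mul (n : ℕ) (c : ℤ_[ℓ]) :
    ∃ (m : ℕ) (d : ℤ_[ℓ]), c = m + (ℓ : ℤ_[ℓ]) ^ n * d := by
  have h := PadicInt.appr_spec n c
  rw [Ideal.mem_span_singleton] at h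
  obtain ⟨d, hd⟩ := h
  exact ⟨c.appr n, d, by rw [← hd]; ring⟩

theorem exists_eq_tmul_add_pow_smul (n : ℕ) (z : ℤ_[ℓ] ⊗[ℤ] A) :
    ∃ (a : A) (w : ℤ_[ℓ] ⊗[ℤ] A), z = 1 ⊗ₜ a + (ℓ : ℤ_[ℓ]) ^ n • w := by
  induction z with
  | zero => exact ⟨0, 0, by simp⟩
  | tmul c a =>
    obtain ⟨m, d, rfl⟩ := exists_int_add_pow_mul ℓ n c
    refine ⟨m • a, d ⊗ₜ a, ?_⟩
    rw [TensorProduct.add_tmul, TensorProduct.smul_tmul', smul_eq_mul, ← TensorProduct.smul_tmul,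
      nsmul_one]
  | add x y hx hy =>
    obtain ⟨a, w, rfl⟩ := hx
    obtain ⟨b, u, rfl⟩ := hy
    exact ⟨a + b, w + u, by rw [TensorProduct.tmul_add, smul_add]; abel⟩

theorem pow_smul_tmul (n : ℕ) (c : ℤ_[ℓ]) (a : A) :
    (ℓ : ℤ_[ℓ]) ^ n • (c ⊗ₜ[ℤ] a) = c ⊗ₜ[ℤ] (ℓ ^ n • a) := by
  rw [← TensorProduct.smul_tmul, TensorProduct.smul_tmul', nsmul_eq_mul, smul_eq_mul]
  push_cast
  rfl

/-- If `ℓ ^ n` kills `A`, then `ℤ_ℓ` acts on `A` through `ℤ / ℓ ^ n`; this is the action as a map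
`ℤ_ℓ ⊗ A → A`. -/
theorem exists_retraction (n : ℕ) (hA : ∀ a : A, ℓ ^ n • a = 0) :
    ∃ f : ℤ_[ℓ] ⊗[ℤ] A →+ A, ∀ a, f (1 ⊗ₜ a) = a := by
  let : Module (ZMod (ℓ ^ n)) A := AddCommGroup.zmodModule hA
  refine ⟨(TensorProduct.lift (LinearMap.mk₂ ℤ (fun (c : ℤ_[ℓ]) (a : A) =>
    (PadicInt.toZModPow n c) • a) ?_ ?_ ?_ ?_)).toAddMonoidHom, fun a => ?_⟩
  · intro c d a; rw [map_add, add_smul]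
  · intro c d a
    rw [zsmul_eq_mul, map_mul, map_intCast, mul_smul, Int.cast_smul_eq_zsmul]
  · intro c a b; rw [smul_add]
  · intro c d a
    rw [smul_comm]
  · simp

theorem pow_smul_eq_zero_of_killed (n : ℕ) (hA : ∀ a : A, ℓ ^ n • a = 0) (u : ℤ_[ℓ] ⊗[ℤ] A) :
    (ℓ : ℤ_[ℓ]) ^ n • u = 0 := by
  induction u with
  | zero => simp
  | tmul c a => rw [pow_smul_tmul, hA, TensorProduct.tmul_zero]
  | add x y hx hy => rw [smul_add, hx, hy, add_zero]

/-- The quotient of `ℤ_ℓ ⊗ A` by `ℓ ^ n` is `A / ℓ ^ n`. -/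
theorem exists_eq_pow_nsmul_of_tmul (n : ℕ) (a : A) (w : ℤ_[ℓ] ⊗[ℤ] A)
    (h : (1 : ℤ_[ℓ]) ⊗ₜ[ℤ] a = (ℓ : ℤ_[ℓ]) ^ n • w) : ∃ b : A, a = ℓ ^ n • b := by
  let S : AddSubgroup A := (nsmulAddMonoidHom (α := A) (ℓ ^ n)).range
  have hS : ∀ q : A ⧸ S, ℓ ^ n • q = 0 := by
    intro q
    obtain ⟨b, rfl⟩ := QuotientAddGroup.mk_surjective q
    exact (QuotientAddGroup.eq_zero_iff _).2 ⟨b, rfl⟩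
  obtain ⟨f, hf⟩ := exists_retraction ℓ n hS
  have h2 := congrArg (fun t => f (LinearMap.baseChange ℤ_[ℓ]
    (QuotientAddGroup.mk' S).toIntLinearMap t)) h
  simp only [LinearMap.baseChange_tmul, hf, map_smul] at h2
  rw [pow_smul_eq_zero_of_killed ℓ n hS, map_zero] at h2
  obtain ⟨b, hb⟩ := (QuotientAddGroup.eq_zero_iff a).1 h2
  exact ⟨b, hb.symm⟩

/-- Exactness of `ℤ_ℓ ⊗ -`, as `ℤ_ℓ` is torsion-free. -/
theorem baseChange_exact {f : A →ₗ[ℤ] B} {g : B →ₗ[ℤ] C} (h : Function.Exact f g) :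
    Function.Exact (f.baseChange ℤ_[ℓ]) (g.baseChange ℤ_[ℓ]) := by
  have : Module.Flat ℤ ℤ_[ℓ] := inferInstance
  exact Module.Flat.lTensor_exact ℤ_[ℓ] h

/-- The `ℓ ^ k`-torsion of `ℤ_ℓ ⊗ A` is that of `A`. -/
theorem exists_eq_tmul_of_pow_smul_eq_zero (k : ℕ) (z : ℤ_[ℓ] ⊗[ℤ] A)
    (h : (ℓ : ℤ_[ℓ]) ^ k • z = 0) : ∃ a : A, ℓ ^ k • a = 0 ∧ z = 1 ⊗ₜ a := by
  let g : A →ₗ[ℤ] A := (nsmulAddMonoidHom (ℓ ^ k)).toIntLinearMap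
  have hex := baseChange_exact ℓ (LinearMap.exact_subtype_ker_map g)
  have hg : ∀ u : ℤ_[ℓ] ⊗[ℤ] A, g.baseChange ℤ_[ℓ] u = (ℓ : ℤ_[ℓ]) ^ k • u := by
    intro u
    induction u with
    | zero => simp
    | tmul c a => rw [pow_smul_tmul, LinearMap.baseChange_tmul]; rfl
    | add x y hx hy => rw [map_add, smul_add, hx, hy]
  obtain ⟨t, rfl⟩ := (hex z).1 ((hg z).trans h)
  have hker : ∀ a : LinearMap.ker g, ℓ ^ k • a = 0 := fun a => Subtype.ext a.2
  obtain ⟨a, w, rfl⟩ := exists_eq_tmul_add_pow_smul ℓ k t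
  exact ⟨a, a.2, by simp [pow_smul_eq_zero_of_killed ℓ k hker w]⟩

/-- The `ℓ ^ k`-torsion of `A` injects into `ℤ_ℓ ⊗ A`. -/
theorem eq_zero_of_tmul_eq_zero (k : ℕ) {a : A} (ha : ℓ ^ k • a = 0)
    (h : (1 : ℤ_[ℓ]) ⊗ₜ[ℤ] a = 0) : a = 0 := by
  let g : A →ₗ[ℤ] A := (nsmulAddMonoidHom (ℓ ^ k)).toIntLinearMap
  have hker : ∀ b : LinearMap.ker g, ℓ ^ k • b = 0 := fun b => Subtype.ext b.2
  obtain ⟨f, hf⟩ := exists_retraction ℓ k hker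
  have hinj := Module.Flat.lTensor_preserves_injective_linearMap (M := ℤ_[ℓ])
    (LinearMap.ker g).subtype Subtype.val_injective
  have h0 : (1 : ℤ_[ℓ]) ⊗ₜ[ℤ] (⟨a, ha⟩ : LinearMap.ker g) = 0 := hinj (by simpa using h)
  have h1 := hf ⟨a, ha⟩
  rw [h0, map_zero] at h1
  exact (congrArg Subtype.val h1).symm

theorem exists_pow_mul_unit {N : ℕ} (hN : 0 < N) :
    ∃ (k : ℕ) (u : ℤ_[ℓ]ˣ), (N : ℤ_[ℓ]) = u * (ℓ : ℤ_[ℓ]) ^ k := by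
  have h0 : (N : ℤ_[ℓ]) ≠ 0 := by exact_mod_cast hN.ne'
  exact ⟨_, _, PadicInt.unitCoeff_spec h0⟩

theorem eq_zero_of_forall_pow_dvd (c : ℤ_[ℓ]) (h : ∀ n : ℕ, (ℓ : ℤ_[ℓ]) ^ n ∣ c) : c = 0 := by
  by_contra hc
  have h1 := (PadicInt.mem_span_pow_iff_le_valuation c hc (c.valuation + 1)).1
    (Ideal.mem_span_singleton.2 (h _))
  omega

/-- `z` becomes torsion in the `ℓ`-adic completion of `ℤ_ℓ ⊗ A`: some positive multiple of it is
infinitely `ℓ`-divisible. -/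
def IsTorsionMod (z : ℤ_[ℓ] ⊗[ℤ] A) : Prop :=
  ∃ N : ℕ, 0 < N ∧ ∀ n : ℕ, ∃ w : ℤ_[ℓ] ⊗[ℤ] A, N • z = (ℓ : ℤ_[ℓ]) ^ n • w

variable {ℓ}

theorem IsTorsionMod.map {z : ℤ_[ℓ] ⊗[ℤ] A} (hz : IsTorsionMod ℓ z)
    (f : ℤ_[ℓ] ⊗[ℤ] A →ₗ[ℤ_[ℓ]] ℤ_[ℓ] ⊗[ℤ] B) : IsTorsionMod ℓ (f z) := by
  obtain ⟨N, hN, h⟩ := hz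
  refine ⟨N, hN, fun n => ?_⟩
  obtain ⟨w, hw⟩ := h n
  exact ⟨f w, by rw [← map_nsmul, hw, map_smul]⟩

theorem IsTorsionMod.of_nsmul {z : ℤ_[ℓ] ⊗[ℤ] A} {d : ℕ} (hd : 0 < d)
    (hz : IsTorsionMod ℓ (d • z)) : IsTorsionMod ℓ z := by
  obtain ⟨N, hN, h⟩ := hz
  exact ⟨N * d, Nat.mul_pos hN hd, fun n => by simpa [mul_smul] using h n⟩

/-- A linear form with values in `ℤ_ℓ` is continuous and has no torsion in its target. -/
theorem IsTorsionMod.form_eq_zero {z : ℤ_[ℓ] ⊗[ℤ] A} (hz : IsTorsionMod ℓ z)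
    (f : ℤ_[ℓ] ⊗[ℤ] A →ₗ[ℤ_[ℓ]] ℤ_[ℓ]) : f z = 0 := by
  obtain ⟨N, hN, h⟩ := hz
  have h0 : (N : ℤ_[ℓ]) ≠ 0 := by exact_mod_cast hN.ne'
  have h1 : (N : ℤ_[ℓ]) * f z = 0 := by
    refine eq_zero_of_forall_pow_dvd ℓ _ fun n => ?_
    obtain ⟨w, hw⟩ := h n
    exact ⟨f w, by rw [← nsmul_eq_mul, ← map_nsmul, hw, map_smul, smul_eq_mul]⟩
  exact (mul_eq_zero.1 h1).resolve_left h0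

/-- If `A` has finitely many `ℓ ^ k`-torsion elements for each `k`, then an element of `ℤ_ℓ ⊗ A`
which is torsion in the completion agrees there with a torsion element of `A`. -/
theorem IsTorsionMod.exists_torsion {z : ℤ_[ℓ] ⊗[ℤ] A} (hz : IsTorsionMod ℓ z)
    (hfin : ∀ k, {a : A | ℓ ^ k • a = 0}.Finite) :
    ∃ (a : A) (k : ℕ), ℓ ^ k • a = 0 ∧
      ∀ n : ℕ, ∃ w : ℤ_[ℓ] ⊗[ℤ] A, z - 1 ⊗ₜ a = (ℓ : ℤ_[ℓ]) ^ n • w := by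
  obtain ⟨N, hN, h⟩ := hz
  obtain ⟨k, u, hu⟩ := exists_pow_mul_unit ℓ hN
  have hlev : ∀ n : ℕ, ∃ (a : A), ℓ ^ k • a = 0 ∧
      ∃ w : ℤ_[ℓ] ⊗[ℤ] A, z - 1 ⊗ₜ a = (ℓ : ℤ_[ℓ]) ^ n • w := by
    intro n
    obtain ⟨w, hw⟩ := h (k + n)
    have h1 : (ℓ : ℤ_[ℓ]) ^ k • (z - (ℓ : ℤ_[ℓ]) ^ n • ((u⁻¹ : ℤ_[ℓ]ˣ) : ℤ_[ℓ]) • w) = 0 := by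
      have h2 : (u : ℤ_[ℓ]) • (ℓ : ℤ_[ℓ]) ^ k • z = (ℓ : ℤ_[ℓ]) ^ (k + n) • w := by
        rw [← mul_smul, ← hu, ← hw, Nat.cast_smul_eq_nsmul]
      have h3 : (ℓ : ℤ_[ℓ]) ^ k • z = ((u⁻¹ : ℤ_[ℓ]ˣ) : ℤ_[ℓ]) • (ℓ : ℤ_[ℓ]) ^ (k + n) • w := by
        rw [← h2, ← mul_smul, Units.inv_mul, one_smul]
      rw [smul_sub, h3, ← mul_smul, ← mul_smul, ← mul_smul, pow_add, mul_comm, mul_assoc, sub_self]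
    obtain ⟨a, ha, hza⟩ := exists_eq_tmul_of_pow_smul_eq_zero ℓ k _ h1
    exact ⟨a, ha, _, by rw [← hza, sub_sub_cancel]⟩
  choose a ha w hw using hlev
  have : Finite {a : A | ℓ ^ k • a = 0} := hfin k
  -- Some torsion element serves for infinitely many levels `n`.
  obtain ⟨b, hb⟩ := Finite.exists_infinite_fiber
    (fun n : ℕ => (⟨a n, ha n⟩ : {a : A | ℓ ^ k • a = 0}))
  refine ⟨b, k, b.2, fun n => ?_⟩
  obtain ⟨m, hm, hnm⟩ := (Set.infinite_coe_iff.1 hb).exists_gt n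
  have hmb : a m = b := congrArg Subtype.val hm
  refine ⟨(ℓ : ℤ_[ℓ]) ^ (m - n) • w m, ?_⟩
  rw [← hmb, hw, ← mul_smul, ← pow_add, Nat.add_sub_cancel' hnm.le]

end AdicTensor

/-! ### Local conditions at the places above `ℓ` -/

section Fields
variable {ℓ : ℕ} [Fact ℓ.Prime] {E F G : Type*} [Field E] [Field F] [Field G]

/-- The class of `x` in `ℤ_ℓ ⊗ F^×`. -/
abbrev ofUnit (ℓ : ℕ) [Fact ℓ.Prime] (x : Fˣ) : AdicUnits ℓ F := 1 ⊗ₜ[ℤ] Additive.ofMul x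

theorem AdicUnits.map_tmul (f : E →+* F) (c : ℤ_[ℓ]) (x : Additive Eˣ) :
    AdicUnits.map ℓ f (c ⊗ₜ x) =
      c ⊗ₜ Additive.ofMul (Units.map f.toMonoidHom x.toMul) := rfl

theorem ofUnit_mul (x y : Fˣ) : ofUnit ℓ (x * y) = ofUnit ℓ x + ofUnit ℓ y := by
  rw [ofUnit, ofMul_mul, TensorProduct.tmul_add]

theorem ofUnit_pow (x : Fˣ) (n : ℕ) : ofUnit ℓ (x ^ n) = n • ofUnit ℓ x := by
  rw [ofUnit, ofMul_pow, TensorProduct.tmul_smul]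

theorem AdicUnits.map_ofUnit (f : E →+* F) (x : Eˣ) :
    AdicUnits.map ℓ f (ofUnit ℓ x) = ofUnit ℓ (Units.map f.toMonoidHom x) := rfl

theorem AdicUnits.map_map (g : F →+* G) (f : E →+* F) (x : AdicUnits ℓ E) :
    AdicUnits.map ℓ g (AdicUnits.map ℓ f x) = AdicUnits.map ℓ (g.comp f) x := by
  induction x using TensorProduct.induction_on with
  | zero => simp
  | tmul c a => rfl
  | add x y hx hy => simp only [map_add, hx, hy]

theorem mem_pow_smul_top_iff (n : ℕ) (z : AdicUnits ℓ F) :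
    z ∈ (Ideal.span {(ℓ : ℤ_[ℓ])} ^ n • ⊤ : Submodule ℤ_[ℓ] (AdicUnits ℓ F)) ↔
      ∃ w, z = (ℓ : ℤ_[ℓ]) ^ n • w := by
  rw [Ideal.span_singleton_pow, Submodule.ideal_span_singleton_smul]
  constructor
  · rintro ⟨w, -, rfl⟩; exact ⟨w, rfl⟩
  · rintro ⟨w, rfl⟩; exact ⟨w, trivial, rfl⟩

theorem toProAdic_eq_zero_iff (z : AdicUnits ℓ F) :
    toProAdic ℓ F z = 0 ↔ ∀ n : ℕ, ∃ w, z = (ℓ : ℤ_[ℓ]) ^ n • w := by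
  simp_rw [← mem_pow_smul_top_iff]
  constructor
  · intro h n
    have h1 := congrArg (AdicCompletion.eval (Ideal.span {(ℓ : ℤ_[ℓ])}) (AdicUnits ℓ F) n) h
    rwa [toProAdic, AdicCompletion.eval_of, map_zero, Submodule.mkQ_apply,
      Submodule.Quotient.mk_eq_zero] at h1
  · intro h
    refine AdicCompletion.ext fun n => ?_
    rw [toProAdic, AdicCompletion.of_apply, Submodule.mkQ_apply]
    exact (Submodule.Quotient.mk_eq_zero _).2 (h n)

theorem exists_nsmul_eq_zero_of_mem_rootsOfUnityProAdic {z : ProAdicUnits ℓ F}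
    (hz : z ∈ rootsOfUnityProAdic ℓ F) : ∃ N : ℕ, 0 < N ∧ N • z = 0 := by
  induction hz using Submodule.span_induction with
  | mem x h =>
    obtain ⟨ζ, hζ, rfl⟩ := h
    refine ⟨orderOf ζ, hζ.orderOf_pos, ?_⟩
    rw [← map_nsmul, ← ofUnit_pow, pow_orderOf_eq_one, ofUnit, ofMul_one, TensorProduct.tmul_zero,
      map_zero]
  | zero => exact ⟨1, one_pos, by simp⟩
  | add x y _ _ hx hy =>
    obtain ⟨M, hM, hx⟩ := hx
    obtain ⟨N, hN, hy⟩ := hy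
    refine ⟨M * N, Nat.mul_pos hM hN, ?_⟩
    rw [smul_add, mul_comm M N, mul_smul, hx, mul_comm N M, mul_smul, hy,
      smul_zero, smul_zero, add_zero]
  | smul c x _ hx =>
    obtain ⟨M, hM, hx⟩ := hx
    exact ⟨M, hM, by rw [smul_comm, hx, smul_zero]⟩

/-- The elements of `ℤ_ℓ ⊗ F^×` whose image in `lim F^× / F^{× ℓ^n}` is a root of unity are those
whose image is torsion. -/
theorem toProAdic_mem_rootsOfUnityProAdic_iff (z : AdicUnits ℓ F) :
    toProAdic ℓ F z ∈ rootsOfUnityProAdic ℓ F ↔ IsTorsionMod ℓ z := by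
  constructor
  · intro h
    obtain ⟨N, hN, h⟩ := exists_nsmul_eq_zero_of_mem_rootsOfUnityProAdic h
    rw [← map_nsmul, toProAdic_eq_zero_iff] at h
    exact ⟨N, hN, h⟩
  · intro h
    have hpos : ∀ k, 0 < ℓ ^ k := fun k => pow_pos (Fact.out : ℓ.Prime).pos k
    obtain ⟨a, k, ha, h⟩ := h.exists_torsion (fun k => by
      have : NeZero (ℓ ^ k) := ⟨(hpos k).ne'⟩
      have hf : Finite (rootsOfUnity (ℓ ^ k) F) := inferInstance
      exact Set.toFinite (rootsOfUnity (ℓ ^ k) F : Set Fˣ))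
    rw [← toProAdic_eq_zero_iff, map_sub, sub_eq_zero] at h
    rw [h]
    exact Submodule.subset_span ⟨a.toMul, isOfFinOrder_iff_pow_eq_one.2 ⟨ℓ ^ k, hpos k, ha⟩, rfl⟩

end Fields

section Places
variable {ℓ : ℕ} [Fact ℓ.Prime] {K : Type*} [Field K] [NumberField K]

theorem mem_pseudoInf_iff (x : AdicUnits ℓ K) :
    x ∈ pseudoInf ℓ K ↔ ∀ v : HeightOneSpectrum (𝓞 K), Above ℓ K v →
      IsTorsionMod ℓ (AdicUnits.map ℓ (algebraMap K (v.adicCompletion K)) x) := by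
  simp only [pseudoInf, Submodule.mem_iInf, Submodule.mem_comap,
    ← toProAdic_mem_rootsOfUnityProAdic_iff]
  rfl

theorem logVal_of_above {v : HeightOneSpectrum (𝓞 K)} (hv : Above ℓ K v) (x : AdicUnits ℓ K) :
    logVal ℓ v x = normalizeForm ℓ (localLog ℓ v hv)
      (AdicUnits.map ℓ (algebraMap K (v.adicCompletion K)) x) := by
  rw [logVal, dif_pos hv]; rfl

theorem logVal_of_not_above {v : HeightOneSpectrum (𝓞 K)} (hv : ¬ Above ℓ K v) :
    logVal ℓ v = ord ℓ v := by
  rw [logVal, dif_neg hv]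

theorem normalizeForm_eq_zero_iff {M : Type*} [AddCommGroup M] [Module ℤ_[ℓ] M]
    (f : M →ₗ[ℤ_[ℓ]] ℤ_[ℓ]) (x : M) : normalizeForm ℓ f x = 0 ↔ f x = 0 := by
  rw [normalizeForm]
  split_ifs with hg
  · have h0 : LinearMap.range f = ⊥ := (Submodule.IsPrincipal.eq_bot_iff_generator_eq_zero _).2 hg
    rw [LinearMap.range_eq_bot] at h0
    simp [h0]
  · have h : ∀ x, ∃ c, f x = Submodule.IsPrincipal.generator (LinearMap.range f) * c := fun x =>
      (Submodule.IsPrincipal.mem_iff_generator_dvd _).1 (LinearMap.mem_range_self f x)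
    change (h x).choose = 0 ↔ _
    have h1 := (h x).choose_spec
    constructor
    · intro h2; rw [h1, h2, mul_zero]
    · intro h2
      exact (mul_eq_zero.1 (h1.symm.trans h2)).resolve_left hg

theorem logVal_eq_zero_iff_localLog {v : HeightOneSpectrum (𝓞 K)} (hv : Above ℓ K v)
    (x : AdicUnits ℓ K) : logVal ℓ v x = 0 ↔ localLog ℓ v hv
      (AdicUnits.map ℓ (algebraMap K (v.adicCompletion K)) x) = 0 := by
  rw [logVal_of_above hv, normalizeForm_eq_zero_iff]

theorem ord_tmul (v : HeightOneSpectrum (𝓞 K)) (c : ℤ_[ℓ]) (x : Kˣ) :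
    ord ℓ v (c ⊗ₜ Additive.ofMul x) = c * ((-(v.valuationOfNeZero x).toAdd : ℤ) : ℤ_[ℓ]) := by
  simp [ord]

theorem ord_ofUnit (v : HeightOneSpectrum (𝓞 K)) (x : Kˣ) :
    ord ℓ v (ofUnit ℓ x) = ((-(v.valuationOfNeZero x).toAdd : ℤ) : ℤ_[ℓ]) := by
  rw [ofUnit, ord_tmul, one_mul]

/-- At a place above `ℓ`, logarithmic valuations kill the local roots of unity. -/
theorem logVal_eq_zero_of_mem_pseudoInf {x : AdicUnits ℓ K} (hx : x ∈ pseudoInf ℓ K)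
    {v : HeightOneSpectrum (𝓞 K)} (hv : Above ℓ K v) : logVal ℓ v x = 0 :=
  (logVal_eq_zero_iff_localLog hv x).2 (((mem_pseudoInf_iff x).1 hx v hv).form_eq_zero _)

end Places

section Extension
variable {ℓ : ℕ} [Fact ℓ.Prime] {K L : Type*} [Field K] [NumberField K] [Field L] [NumberField L]
  [Algebra K L] (w : HeightOneSpectrum (𝓞 L))

variable (K) in
omit [Fact ℓ.Prime] [NumberField K] [NumberField L] in
theorem above_under_iff : Above ℓ K (w.under (𝓞 K)) ↔ Above ℓ L w := by
  change algebraMap (𝓞 K) (𝓞 L) (ℓ : 𝓞 K) ∈ w.asIdeal ↔ _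
  rw [map_natCast]; rfl

theorem valuation_under (x : K) :
    w.valuation L (algebraMap K L x) =
      (w.under (𝓞 K)).valuation K x ^
        Ideal.ramificationIdx' (w.under (𝓞 K)).asIdeal w.asIdeal := by
  have : w.asIdeal.LiesOver (w.under (𝓞 K)).asIdeal := ⟨rfl⟩
  exact (HeightOneSpectrum.valuation_liesOver L (w.under (𝓞 K)) w x).symm

variable (K) in
omit [NumberField K] in
theorem ramificationIdx_under_ne_zero :
    Ideal.ramificationIdx' (w.under (𝓞 K)).asIdeal w.asIdeal ≠ 0 := by
  have : w.asIdeal.LiesOver (w.under (𝓞 K)).asIdeal := ⟨rfl⟩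
  exact Ideal.IsDedekindDomain.ramificationIdx'_ne_zero_of_liesOver w.asIdeal (w.under (𝓞 K)).ne_bot

theorem ord_map (x : AdicUnits ℓ K) :
    ord ℓ w (AdicUnits.map ℓ (algebraMap K L) x) =
      (Ideal.ramificationIdx' (w.under (𝓞 K)).asIdeal w.asIdeal : ℤ_[ℓ]) *
        ord ℓ (w.under (𝓞 K)) x := by
  induction x using TensorProduct.induction_on with
  | zero => simp
  | add x y hx hy => simp only [map_add, hx, hy, mul_add]
  | tmul c a =>
    have h : w.valuationOfNeZero (Units.map (algebraMap K L).toMonoidHom a.toMul) =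
        (w.under (𝓞 K)).valuationOfNeZero a.toMul ^
          Ideal.ramificationIdx' (w.under (𝓞 K)).asIdeal w.asIdeal := by
      rw [← WithZero.coe_inj, WithZero.coe_pow, HeightOneSpectrum.valuationOfNeZero_eq,
        HeightOneSpectrum.valuationOfNeZero_eq]
      exact valuation_under w _
    rw [AdicUnits.map_tmul, ord_tmul, h]
    refine Eq.trans ?_ (congrArg _ (ord_tmul (w.under (𝓞 K)) c a.toMul).symm)
    rw [toAdd_pow]
    push_cast
    rw [nsmul_eq_mul]
    push_cast
    ring

theorem completionMap_algebraMap {A : Type*} [CommRing A] [IsDedekindDomain A]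
    (F : Type*) [Field F] [Algebra A F] [IsFractionRing A F]
    (L : Type*) [Field L] [NumberField L] [Algebra F L] [Algebra A (𝓞 L)] [Algebra A L]
    [IsScalarTower A F L] [IsScalarTower A (𝓞 L) L] [Module.IsTorsionFree A (𝓞 L)]
    (v : HeightOneSpectrum A) (w : HeightOneSpectrum (𝓞 L)) (h : w.asIdeal.LiesOver v.asIdeal)
    (x : F) : completionMap F L v w h (algebraMap F (v.adicCompletion F) x) =
      algebraMap L (w.adicCompletion L) (algebraMap F L x) := by
  apply HeightOneSpectrum.adicCompletion.ext
  exact UniformSpace.Completion.mapRingHom_coe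
    (HeightOneSpectrum.uniformContinuous_algebraMap_liesOver F L v w).continuous _

theorem continuous_completionMap {A : Type*} [CommRing A] [IsDedekindDomain A]
    (F : Type*) [Field F] [Algebra A F] [IsFractionRing A F]
    (L : Type*) [Field L] [NumberField L] [Algebra F L] [Algebra A (𝓞 L)] [Algebra A L]
    [IsScalarTower A F L] [IsScalarTower A (𝓞 L) L] [Module.IsTorsionFree A (𝓞 L)]
    (v : HeightOneSpectrum A) (w : HeightOneSpectrum (𝓞 L))
    (h : w.asIdeal.LiesOver v.asIdeal) : Continuous (completionMap F L v w h) :=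
  (HeightOneSpectrum.adicCompletion.continuous_ofCompletion L w).comp <|
    UniformSpace.Completion.continuous_map.comp
      (HeightOneSpectrum.adicCompletion.continuous_toCompletion F v)

variable (K) in
/-- The homomorphism `K_v → L_w` for the place `v` of `K` below `w`. -/
abbrev completionUnderMap : (w.under (𝓞 K)).adicCompletion K →+* w.adicCompletion L :=
  completionMap K L (w.under (𝓞 K)) w ⟨rfl⟩

/-- Localization commutes with extension of the base field. -/
theorem map_completionUnderMap (x : AdicUnits ℓ K) :
    AdicUnits.map ℓ (completionUnderMap K w)
        (AdicUnits.map ℓ (algebraMap K ((w.under (𝓞 K)).adicCompletion K)) x) =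
      AdicUnits.map ℓ (algebraMap L (w.adicCompletion L))
        (AdicUnits.map ℓ (algebraMap K L) x) := by
  have h : (completionUnderMap K w).comp
      (algebraMap K ((w.under (𝓞 K)).adicCompletion K)) =
      (algebraMap L (w.adicCompletion L)).comp (algebraMap K L) :=
    RingHom.ext fun x => completionMap_algebraMap K L (w.under (𝓞 K)) w ⟨rfl⟩ x
  rw [AdicUnits.map_map, AdicUnits.map_map, h]

theorem map_mem_pseudoInf {x : AdicUnits ℓ K} (hx : x ∈ pseudoInf ℓ K) :
    AdicUnits.map ℓ (algebraMap K L) x ∈ pseudoInf ℓ L := by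
  rw [mem_pseudoInf_iff] at hx ⊢
  intro w hw
  rw [← map_completionUnderMap (K := K)]
  have hv : Above ℓ K (w.under (𝓞 K)) := (above_under_iff K w).2 hw
  have h := hx (w.under (𝓞 K)) hv
  exact IsTorsionMod.map h (AdicUnits.map ℓ (completionUnderMap K w))

end Extension

section LocalNorm
variable {ℓ : ℕ} [Fact ℓ.Prime] {K : Type*} [Field K] [NumberField K]

theorem continuous_padicToCompletion (v : HeightOneSpectrum (𝓞 K)) (hv : Above ℓ K v) :
    Continuous (padicToCompletion ℓ v hv) :=
  (continuous_completionMap ℚ K (ratPlace ℓ) v (liesOver_ratPlace ℓ v hv)).comp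
    (Padic.adicCompletionEquiv ℤ ⟨ℓ, Fact.out⟩ : ℚ_[ℓ] ≃A[ℚ] _).continuous

/-- `K_v` is finite over `ℚ_ℓ`: the `ℚ_ℓ`-span of `K` is finite-dimensional, hence closed, and dense. -/
theorem finite_padicToCompletion (v : HeightOneSpectrum (𝓞 K)) (hv : Above ℓ K v) :
    (padicToCompletion ℓ v hv).Finite := by
  let := (padicToCompletion ℓ v hv).toAlgebra
  change Module.Finite ℚ_[ℓ] (v.adicCompletion K)
  have hc : ContinuousSMul ℚ_[ℓ] (v.adicCompletion K) := ⟨by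
    simp_rw [Algebra.smul_def]
    exact ((continuous_padicToCompletion v hv).comp continuous_fst).mul continuous_snd⟩
  let b := Module.finBasis ℚ K
  let W : Submodule ℚ_[ℓ] (v.adicCompletion K) :=
    Submodule.span ℚ_[ℓ] (Set.range fun i => algebraMap K (v.adicCompletion K) (b i))
  have hW : FiniteDimensional ℚ_[ℓ] W := FiniteDimensional.span_of_finite _ (Set.finite_range _)
  have hsub : Set.range (algebraMap K (v.adicCompletion K)) ⊆ W := by
    rintro _ ⟨x, rfl⟩
    rw [← b.sum_repr x, map_sum]
    refine Submodule.sum_mem _ fun i _ => ?_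
    have h1 : algebraMap K (v.adicCompletion K) (b.repr x i • b i) =
        (b.repr x i : ℚ_[ℓ]) • algebraMap K (v.adicCompletion K) (b i) := by
      rw [Algebra.smul_def, Algebra.smul_def, map_mul, eq_ratCast, map_ratCast, map_ratCast]
    rw [h1]
    exact Submodule.smul_mem _ _ (Submodule.subset_span ⟨i, rfl⟩)
  have hclosed : IsClosed (W : Set (v.adicCompletion K)) := W.closed_of_finiteDimensional
  have htop : W = ⊤ := by
    rw [eq_top_iff]
    intro x _
    exact closure_minimal hsub hclosed (v.denseRange_algebraMap K x)
  rw [Module.finite_def, ← htop]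
  exact Submodule.fg_span (Set.finite_range _)

variable {L : Type*} [Field L] [NumberField L] [Algebra K L] (w : HeightOneSpectrum (𝓞 L))

theorem completionUnderMap_comp_padicToCompletion (hw : Above ℓ L w)
    (hv : Above ℓ K (w.under (𝓞 K))) :
    (completionUnderMap K w).comp (padicToCompletion ℓ (w.under (𝓞 K)) hv) =
      padicToCompletion ℓ w hw := by
  have h : ⇑((completionUnderMap K w).comp (padicToCompletion ℓ (w.under (𝓞 K)) hv)) =
      ⇑(padicToCompletion ℓ w hw) := by
    refine (Padic.denseRange_ratCast ℓ).equalizer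
      ((continuous_completionMap K L (w.under (𝓞 K)) w ⟨rfl⟩).comp (continuous_padicToCompletion _ hv))
      (continuous_padicToCompletion w hw) ?_
    funext q
    simp
  exact RingHom.ext fun x => congrFun h x

variable (K) in
theorem finite_completionUnderMap (hw : Above ℓ L w) : (completionUnderMap K w).Finite := by
  have h := finite_padicToCompletion w hw
  rw [← completionUnderMap_comp_padicToCompletion w hw ((above_under_iff K w).2 hw)] at h
  exact h.of_comp_finite

variable (K) in
/-- The degree of `L_w / K_v`. -/
def localDegree : ℕ :=
  letI := (completionUnderMap K w).toAlgebra
  Module.finrank ((w.under (𝓞 K)).adicCompletion K) (w.adicCompletion L)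

variable (K) in
theorem localDegree_pos (hw : Above ℓ L w) : 0 < localDegree K w := by
  let := (completionUnderMap K w).toAlgebra
  have : Module.Finite ((w.under (𝓞 K)).adicCompletion K) (w.adicCompletion L) :=
    finite_completionUnderMap K w hw
  exact Module.finrank_pos

theorem localNorm_completionUnderMap (hw : Above ℓ L w) (hv : Above ℓ K (w.under (𝓞 K)))
    (x : (w.under (𝓞 K)).adicCompletion K) :
    localNorm ℓ w hw (completionUnderMap K w x) =
      localNorm ℓ (w.under (𝓞 K)) hv x ^ localDegree K w := by
  let := (completionUnderMap K w).toAlgebra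
  let := (padicToCompletion ℓ w hw).toAlgebra
  let := (padicToCompletion ℓ (w.under (𝓞 K)) hv).toAlgebra
  have : IsScalarTower ℚ_[ℓ] ((w.under (𝓞 K)).adicCompletion K) (w.adicCompletion L) :=
    .of_algebraMap_eq' (completionUnderMap_comp_padicToCompletion w hw hv).symm
  have : Module.Finite ((w.under (𝓞 K)).adicCompletion K) (w.adicCompletion L) :=
    finite_completionUnderMap K w hw
  have : Module.Finite ℚ_[ℓ] ((w.under (𝓞 K)).adicCompletion K) :=
    finite_padicToCompletion _ hv
  change Algebra.norm ℚ_[ℓ] (algebraMap _ _ x) = (Algebra.norm ℚ_[ℓ] x) ^ _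
  rw [← Algebra.norm_norm (S := (w.under (𝓞 K)).adicCompletion K), Algebra.norm_algebraMap, map_pow]
  rfl

/-- Transitivity of the norm in `L_w / K_v / ℚ_ℓ`. -/
theorem localLog_completionUnderMap (hw : Above ℓ L w) (hv : Above ℓ K (w.under (𝓞 K)))
    (x : AdicUnits ℓ ((w.under (𝓞 K)).adicCompletion K)) :
    localLog ℓ w hw (AdicUnits.map ℓ (completionUnderMap K w) x) =
      localDegree K w * localLog ℓ (w.under (𝓞 K)) hv x := by
  induction x using TensorProduct.induction_on with
  | zero => simp
  | add x y hx hy => simp only [map_add, hx, hy, mul_add]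
  | tmul c a =>
    have h : Units.map (localNorm ℓ w hw)
          (Units.map (completionUnderMap K w).toMonoidHom a.toMul) =
        Units.map (localNorm ℓ (w.under (𝓞 K)) hv) a.toMul ^ localDegree K w := by
      apply Units.ext
      exact localNorm_completionUnderMap w hw hv _
    rw [AdicUnits.map_tmul, localLog, localLog, LinearMap.liftBaseChange_tmul,
      LinearMap.liftBaseChange_tmul]
    change c • (-(iwasawaLog ℓ (Additive.ofMul (Units.map (localNorm ℓ w hw)
      (Units.map (completionUnderMap K w).toMonoidHom a.toMul))))) =
      _ * c • (-(iwasawaLog ℓ (Additive.ofMul (Units.map (localNorm ℓ _ hv) a.toMul))))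
    rw [h, ofMul_pow, map_nsmul, nsmul_eq_mul, smul_eq_mul, smul_eq_mul]
    ring

theorem logVal_map_eq_zero_iff (x : AdicUnits ℓ K) :
    logVal ℓ w (AdicUnits.map ℓ (algebraMap K L) x) = 0 ↔ logVal ℓ (w.under (𝓞 K)) x = 0 := by
  by_cases hw : Above ℓ L w
  · have hv : Above ℓ K (w.under (𝓞 K)) := (above_under_iff K w).2 hw
    rw [logVal_eq_zero_iff_localLog hw, logVal_eq_zero_iff_localLog hv,
      ← map_completionUnderMap (K := K), localLog_completionUnderMap w hw hv, mul_eq_zero,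
      Nat.cast_eq_zero, or_iff_right (localDegree_pos K w hw).ne']
  · have hv : ¬ Above ℓ K (w.under (𝓞 K)) := fun h => hw ((above_under_iff K w).1 h)
    rw [logVal_of_not_above hw, logVal_of_not_above hv, ord_map, mul_eq_zero,
      Nat.cast_eq_zero, or_iff_right (ramificationIdx_under_ne_zero K w)]

/-- An element of `ℤ_ℓ ⊗ K_v^×` which becomes a root of unity in `L_w` is one, by taking norms. -/
theorem isTorsionMod_of_completionUnderMap (hw : Above ℓ L w)
    {x : AdicUnits ℓ ((w.under (𝓞 K)).adicCompletion K)}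
    (hx : IsTorsionMod ℓ (AdicUnits.map ℓ (completionUnderMap K w) x)) : IsTorsionMod ℓ x := by
  let := (completionUnderMap K w).toAlgebra
  let N : Additive (w.adicCompletion L)ˣ →ₗ[ℤ] Additive ((w.under (𝓞 K)).adicCompletion K)ˣ :=
    (Units.map (Algebra.norm ((w.under (𝓞 K)).adicCompletion K))).toAdditive.toIntLinearMap
  refine IsTorsionMod.of_nsmul (localDegree_pos K w hw) ?_
  have h := hx.map (N.baseChange ℤ_[ℓ])
  convert h using 1
  clear h hx
  induction x using TensorProduct.induction_on with
  | zero => simp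
  | add x y hx hy => simp only [map_add, hx, hy, smul_add]
  | tmul c a =>
    rw [AdicUnits.map_tmul, LinearMap.baseChange_tmul, ← TensorProduct.tmul_smul]
    congr 1
    apply Units.ext
    exact (Algebra.norm_algebraMap _).symm

end LocalNorm

/-! ### Divisors and the product formula -/

section IwasawaLog
variable (ℓ : ℕ) [Fact ℓ.Prime]

theorem iwasawaLog_mul (x y : ℚ_[ℓ]ˣ) : iwasawaLog ℓ (Additive.ofMul (x * y)) =
    iwasawaLog ℓ (Additive.ofMul x) + iwasawaLog ℓ (Additive.ofMul y) := by
  rw [ofMul_mul, map_add]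

theorem iwasawaLog_pow (x : ℚ_[ℓ]ˣ) (n : ℕ) : iwasawaLog ℓ (Additive.ofMul (x ^ n)) =
    n * iwasawaLog ℓ (Additive.ofMul x) := by
  rw [ofMul_pow, map_nsmul, nsmul_eq_mul]

theorem iwasawaLog_zpow (x : ℚ_[ℓ]ˣ) (n : ℤ) : iwasawaLog ℓ (Additive.ofMul (x ^ n)) =
    n * iwasawaLog ℓ (Additive.ofMul x) := by
  rw [ofMul_zpow, map_zsmul, zsmul_eq_mul]

theorem iwasawaLog_neg (x : ℚ_[ℓ]ˣ) :
    iwasawaLog ℓ (Additive.ofMul (-x)) = iwasawaLog ℓ (Additive.ofMul x) := by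
  have h := iwasawaLog_mul ℓ (-1) (-1)
  rw [neg_mul_neg, mul_one, ofMul_one, map_zero, eq_comm, ← two_mul, mul_eq_zero,
    or_iff_right two_ne_zero] at h
  rw [← neg_one_mul, iwasawaLog_mul, h, zero_add]

theorem iwasawaLog_of_norm_eq_one (x : ℚ_[ℓ]ˣ) (u : ℤ_[ℓ]ˣ) (h : (x : ℚ_[ℓ]) = (u : ℤ_[ℓ])) :
    iwasawaLog ℓ (Additive.ofMul x) = unitLog ℓ u := by
  change unitLog ℓ (unitPart ℓ x) = _
  congr 1
  apply Units.ext
  apply Subtype.ext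
  change (x : ℚ_[ℓ]) * (ℓ : ℚ_[ℓ]) ^ (-(x : ℚ_[ℓ]).valuation) = _
  have h0 : (x : ℚ_[ℓ]).valuation = 0 := by
    have h1 := Padic.norm_eq_zpow_neg_valuation x.ne_zero
    rw [h, PadicInt.padic_norm_e_of_padicInt, PadicInt.norm_units, eq_comm,
      zpow_eq_one_iff_right₀ (by positivity)
        (by exact_mod_cast (Fact.out : ℓ.Prime).one_lt.ne')] at h1
    rw [h]
    omega
  rw [h0, h, neg_zero, zpow_zero, mul_one]

theorem pow_dvd_pow_prime_sub_one {m : ℕ} (hm : 0 < m) {u : ℤ_[ℓ]} (h : (ℓ : ℤ_[ℓ]) ^ m ∣ u - 1) :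
    (ℓ : ℤ_[ℓ]) ^ (m + 1) ∣ u ^ ℓ - 1 := by
  obtain ⟨k, hk⟩ := Polynomial.powAddExpansion (1 : ℤ_[ℓ]) (u - 1) ℓ
  rw [add_sub_cancel] at hk
  obtain ⟨c, hc⟩ := h
  obtain ⟨m, rfl⟩ : ∃ m', m = m' + 1 := ⟨m - 1, by omega⟩
  refine ⟨c + k * c ^ 2 * (ℓ : ℤ_[ℓ]) ^ m, ?_⟩
  rw [hk, hc]
  simp only [one_pow, mul_one]
  ring

/-- `Log` maps `1 + ℓ ^ m ℤ_ℓ` into `ℓ ^ m ℤ_ℓ`. -/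
theorem pow_dvd_unitLog {m : ℕ} (hm : 0 < m) {u : ℤ_[ℓ]ˣ} (h : (ℓ : ℤ_[ℓ]) ^ m ∣ (u : ℤ_[ℓ]) - 1) :
    (ℓ : ℤ_[ℓ]) ^ m ∣ unitLog ℓ u := by
  have hpow : ∀ n : ℕ, (ℓ : ℤ_[ℓ]) ^ (m + n) ∣ logPow ℓ n u - 1 := by
    intro n
    have h1 : ∀ n : ℕ, (ℓ : ℤ_[ℓ]) ^ (m + n) ∣ (u : ℤ_[ℓ]) ^ ℓ ^ n - 1 := by
      intro n
      induction n with
      | zero => simpa using h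
      | succ n ih =>
        rw [pow_succ ℓ n, pow_mul]
        exact pow_dvd_pow_prime_sub_one ℓ (Nat.add_pos_left hm n) ih
    refine (h1 n).trans ?_
    change _ ∣ ((u ^ ((ℓ - 1) * ℓ ^ n) : ℤ_[ℓ]ˣ) : ℤ_[ℓ]) - 1
    rw [Units.val_pow_eq_pow_val, mul_comm, pow_mul]
    exact sub_one_dvd_pow_sub_one _ _
  rw [← Ideal.mem_span_singleton, ← PadicInt.norm_le_pow_iff_mem_span_pow]
  refine le_of_tendsto (tendsto_logApprox ℓ u).norm (Eventually.of_forall fun n => ?_)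
  have hp : (0 : ℝ) < ℓ := by exact_mod_cast (Fact.out : ℓ.Prime).pos
  have h1 := (PadicInt.norm_le_pow_iff_mem_span_pow _ _).2
    (Ideal.mem_span_singleton.2 (hpow n))
  rw [logApprox, norm_div, norm_logDenom, div_inv_eq_mul]
  calc ‖((logPow ℓ n u - 1 : ℤ_[ℓ]) : ℚ_[ℓ])‖ * (ℓ : ℝ) ^ n
      ≤ (ℓ : ℝ) ^ (-((m + n : ℕ) : ℤ)) * (ℓ : ℝ) ^ n := by gcongr; exact h1
    _ = (ℓ : ℝ) ^ (-(m : ℤ)) := by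
        rw [← zpow_natCast, ← zpow_add₀ hp.ne']
        congr 1
        push_cast
        ring

end IwasawaLog

section Divisor
variable (ℓ : ℕ) [Fact ℓ.Prime] {K : Type*} [Field K] [NumberField K]

theorem norm_embedding_unit (v : HeightOneSpectrum (𝓞 K)) (x : Kˣ) :
    ‖FinitePlace.embedding v (x : K)‖ =
      ((Ideal.absNorm v.asIdeal : ℕ) : ℝ) ^ (v.valuationOfNeZero x).toAdd := by
  rw [FinitePlace.norm_embedding', ← HeightOneSpectrum.valuationOfNeZero_eq,
    WithZeroMulInt.toNNReal_neg_apply _ WithZero.coe_ne_zero, WithZero.unzero_coe]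
  simp

theorem finite_valuationOfNeZero_ne_one (x : Kˣ) :
    {v : HeightOneSpectrum (𝓞 K) | v.valuationOfNeZero x ≠ 1}.Finite := by
  have h := FinitePlace.hasFiniteMulSupport (K := K) x.ne_zero
  refine (Set.Finite.preimage (f := FinitePlace.mk)
    (fun v _ w _ h => FinitePlace.mk_eq_iff.1 h) h).subset fun v hv => ?_
  rw [Set.mem_preimage, Function.mem_mulSupport, FinitePlace.mk_apply, norm_embedding_unit]
  intro h1
  rw [zpow_eq_one_iff_right₀ (by positivity)
    (by exact_mod_cast (HeightOneSpectrum.one_lt_absNorm v).ne')] at h1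
  exact hv h1

/-- The divisor of a non-zero element of `K`. -/
def intDiv : Additive Kˣ →+ (HeightOneSpectrum (𝓞 K) →₀ ℤ) where
  toFun x := Finsupp.ofSupportFinite (fun v => -(v.valuationOfNeZero x.toMul).toAdd)
    ((finite_valuationOfNeZero_ne_one x.toMul).subset fun v hv h => hv (by simp [h]))
  map_zero' := by ext v; simp [Finsupp.ofSupportFinite]
  map_add' x y := by ext v; simp [Finsupp.ofSupportFinite]; ring

theorem intDiv_apply (x : Kˣ) (v : HeightOneSpectrum (𝓞 K)) :
    intDiv (Additive.ofMul x) v = -(v.valuationOfNeZero x).toAdd := rfl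

/-- The absolute norm of the principal ideal of `x`, from the product formula for absolute values. -/
theorem norm_eq_prod_intDiv (x : Kˣ) :
    |Algebra.norm ℚ (x : K)| = (intDiv (Additive.ofMul x)).prod
      fun v n => ((Ideal.absNorm v.asIdeal : ℕ) : ℚ) ^ n := by
  have h := FinitePlace.prod_eq_inv_abs_norm (K := K) x.ne_zero
  rw [← finprod_comp_equiv FinitePlace.equivHeightOneSpectrum.symm] at h
  have h1 : ∀ v : HeightOneSpectrum (𝓞 K),
      (FinitePlace.equivHeightOneSpectrum.symm v) (x : K) =
        (((Ideal.absNorm v.asIdeal : ℕ) : ℝ) ^ intDiv (Additive.ofMul x) v)⁻¹ := by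
    intro v
    rw [FinitePlace.equivHeightOneSpectrum_symm_apply, norm_embedding_unit, intDiv_apply, zpow_neg,
      inv_inv]
  simp_rw [h1] at h
  rw [finprod_eq_prod_of_mulSupport_subset (s := (intDiv (Additive.ofMul x)).support) _ (by
    intro v hv
    rw [Function.mem_mulSupport] at hv
    rw [SetLike.mem_coe, Finsupp.mem_support_iff]
    rintro h0
    exact hv (by rw [h0, zpow_zero, inv_one])), Finset.prod_inv_distrib, Rat.cast_inv, inv_inj] at h
  apply Rat.cast_injective (α := ℝ)
  rw [← h, Finsupp.prod, Rat.cast_prod]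
  simp only [Rat.cast_zpow, Rat.cast_natCast]

/-- The logarithm `Log (N v)` of the norm of a finite place. -/
def placeLog (v : HeightOneSpectrum (𝓞 K)) : ℤ_[ℓ] :=
  iwasawaLog ℓ (Additive.ofMul (Units.mk0 ((Ideal.absNorm v.asIdeal : ℕ) : ℚ_[ℓ]) (by
    rw [Nat.cast_ne_zero, Ne, Ideal.absNorm_eq_zero_iff]; exact v.ne_bot)))

theorem logDeg_of_not_above {v : HeightOneSpectrum (𝓞 K)} (hv : ¬ Above ℓ K v) :
    logDeg ℓ v = placeLog ℓ v := by
  rw [logDeg, dif_neg hv]; rfl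

/-- The `ℤ_ℓ`-linear extension of `x ↦ Log (N_{K/ℚ} x)`. -/
def normLog : AdicUnits ℓ K →ₗ[ℤ_[ℓ]] ℤ_[ℓ] :=
  LinearMap.liftBaseChange ℤ_[ℓ] ((iwasawaLog ℓ).comp (Units.map
    ((algebraMap ℚ ℚ_[ℓ]).toMonoidHom.comp (Algebra.norm ℚ (S := K)))).toAdditive).toIntLinearMap

theorem normLog_tmul (c : ℤ_[ℓ]) (x : Kˣ) : normLog ℓ (c ⊗ₜ Additive.ofMul x : AdicUnits ℓ K) =
    c * iwasawaLog ℓ (Additive.ofMul (Units.map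
    ((algebraMap ℚ ℚ_[ℓ]).toMonoidHom.comp (Algebra.norm ℚ (S := K))) x)) := by
  simp [normLog]

/-- The divisor map on `ℤ_ℓ ⊗ K^×`. -/
def adicDiv : AdicUnits ℓ K →ₗ[ℤ_[ℓ]] Divisor ℓ K :=
  LinearMap.liftBaseChange ℤ_[ℓ]
    ((Finsupp.mapRange.addMonoidHom (Int.castAddHom ℤ_[ℓ])).comp intDiv).toIntLinearMap

theorem adicDiv_tmul (c : ℤ_[ℓ]) (x : Kˣ) : adicDiv ℓ (c ⊗ₜ Additive.ofMul x : AdicUnits ℓ K) =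
    c • Finsupp.mapRange.addMonoidHom (Int.castAddHom ℤ_[ℓ]) (intDiv (Additive.ofMul x)) := by
  simp [adicDiv]

theorem adicDiv_apply (x : AdicUnits ℓ K) (v : HeightOneSpectrum (𝓞 K)) :
    adicDiv ℓ x v = ord ℓ v x := by
  induction x using TensorProduct.induction_on with
  | zero => simp
  | add x y hx hy => simp only [map_add, Finsupp.add_apply, hx, hy]
  | tmul c a =>
    refine (congrArg (fun d : Divisor ℓ K => d v) (adicDiv_tmul ℓ c a.toMul)).trans
      (Eq.trans ?_ (ord_tmul v c a.toMul).symm)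
    rfl

/-- The product formula: `Log (N_{K/ℚ} x) = ∑ v, ord_v x * Log (N v)`. -/
theorem normLog_eq (x : AdicUnits ℓ K) :
    normLog ℓ x = Finsupp.linearCombination ℤ_[ℓ] (placeLog ℓ) (adicDiv ℓ x) := by
  induction x using TensorProduct.induction_on with
  | zero => simp
  | add x y hx hy => simp only [map_add, hx, hy]
  | tmul c a =>
    refine (normLog_tmul ℓ c a.toMul).trans
      (Eq.trans ?_ (congrArg _ (adicDiv_tmul ℓ c a.toMul)).symm)
    rw [map_smul, smul_eq_mul]
    congr 1
    set x := a.toMul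
    let U : HeightOneSpectrum (𝓞 K) → ℚ_[ℓ]ˣ := fun v =>
      Units.mk0 ((Ideal.absNorm v.asIdeal : ℕ) : ℚ_[ℓ]) (by
        rw [Nat.cast_ne_zero, Ne, Ideal.absNorm_eq_zero_iff]; exact v.ne_bot)
    set y : ℚ_[ℓ]ˣ := Units.map
      ((algebraMap ℚ ℚ_[ℓ]).toMonoidHom.comp (Algebra.norm ℚ (S := K))) x with hy
    have hprod : y = (intDiv (Additive.ofMul x)).prod (fun v n => U v ^ n) ∨
        y = -(intDiv (Additive.ofMul x)).prod (fun v n => U v ^ n) := by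
      have h := congrArg (algebraMap ℚ ℚ_[ℓ]) (norm_eq_prod_intDiv x)
      have h2 : algebraMap ℚ ℚ_[ℓ] ((intDiv (Additive.ofMul x)).prod
          fun v n => ((Ideal.absNorm v.asIdeal : ℕ) : ℚ) ^ n) =
          ((intDiv (Additive.ofMul x)).prod (fun v n => U v ^ n) : ℚ_[ℓ]ˣ) := by
        simp [Finsupp.prod, U]
      rw [h2] at h
      rcases abs_choice (Algebra.norm ℚ (x : K)) with h3 | h3
      · left; apply Units.ext; rw [← h, h3]; rfl
      · right; apply Units.ext; rw [Units.val_neg, ← h, h3, map_neg, neg_neg]; rfl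
    have hlog : iwasawaLog ℓ (Additive.ofMul y) = iwasawaLog ℓ (Additive.ofMul
        ((intDiv (Additive.ofMul x)).prod (fun v n => U v ^ n))) := by
      rcases hprod with h | h
      · rw [h]
      · rw [h, iwasawaLog_neg]
    rw [hlog, Finsupp.prod, ofMul_prod, map_sum, Finsupp.linearCombination_apply,
      Finsupp.mapRange.addMonoidHom_apply, Finsupp.sum_mapRange_index (by simp), Finsupp.sum]
    exact Finset.sum_congr rfl fun v _ => iwasawaLog_zpow ℓ _ _

theorem normLog_map {L : Type*} [Field L] [NumberField L] [Algebra K L] (x : AdicUnits ℓ K) :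
    normLog ℓ (AdicUnits.map ℓ (algebraMap K L) x) = Module.finrank K L * normLog ℓ x := by
  induction x using TensorProduct.induction_on with
  | zero => simp
  | add x y hx hy => simp only [map_add, hx, hy, mul_add]
  | tmul c a =>
    rw [AdicUnits.map_tmul, normLog_tmul]
    refine Eq.trans ?_ (congrArg _ (normLog_tmul ℓ c a.toMul)).symm
    rw [mul_left_comm, ← iwasawaLog_pow, ← map_pow]
    congr 4
    apply Units.ext
    change algebraMap ℚ ℚ_[ℓ] (Algebra.norm ℚ (algebraMap K L a.toMul)) =
      (algebraMap ℚ ℚ_[ℓ] (Algebra.norm ℚ ((a.toMul ^ _ : Kˣ) : K)))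
    rw [← Algebra.norm_norm (S := K), Algebra.norm_algebraMap, Units.val_pow_eq_pow_val]

end Divisor

/-! ### Norms of elements which are local powers at the places above `ℓ` -/

section NormCongruence
variable {K : Type*} [Field K] [NumberField K]

/-- The norm is the determinant of an integral matrix, so it respects congruences modulo `n`. -/
theorem dvd_norm_add_mul_sub_norm (n : ℕ) (x y : 𝓞 K) :
    (n : ℤ) ∣ Algebra.norm ℤ (x + n * y) - Algebra.norm ℤ x := by
  classical
  let b := Module.Free.chooseBasis ℤ (𝓞 K)
  rw [← ZMod.intCast_eq_intCast_iff_dvd_sub, eq_comm, Algebra.norm_eq_matrix_det b,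
    Algebra.norm_eq_matrix_det b]
  change Int.castRingHom (ZMod n) _ = Int.castRingHom (ZMod n) _
  rw [RingHom.map_det, RingHom.map_det, ← nsmul_eq_mul, map_add, map_nsmul, map_add, map_nsmul]
  congr 1
  ext i j
  simp

theorem dvd_norm_sub_one_of_sub_one {n : ℕ} {x d : 𝓞 K} (h : x = 1 + n * d) :
    (n : ℤ) ∣ Algebra.norm ℤ x - 1 := by
  rw [h]
  simpa using dvd_norm_add_mul_sub_norm n 1 d

variable (ℓ : ℕ) [Fact ℓ.Prime]

/-- An element of `K` which is integral at the places above `ℓ` has a denominator `≡ 1` modulo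
`ℓ`. -/
theorem exists_denominator (t : K)
    (ht : ∀ v : HeightOneSpectrum (𝓞 K), Above ℓ K v → v.valuation K t ≤ 1) :
    ∃ b d s : 𝓞 K, b = 1 + ℓ * d ∧ (b : K) * t = s := by
  let I : Ideal (𝓞 K) :=
    { carrier := {b | ∃ s : 𝓞 K, (b : K) * t = s}
      zero_mem' := ⟨0, by simp⟩
      add_mem' := by
        rintro a b ⟨s, hs⟩ ⟨u, hu⟩
        exact ⟨s + u, by push_cast; rw [add_mul, hs, hu]⟩
      smul_mem' := by
        rintro c b ⟨s, hs⟩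
        exact ⟨c * s, by rw [smul_eq_mul]; push_cast; rw [mul_assoc, hs]⟩ }
  have htop : I ⊔ Ideal.span {(ℓ : 𝓞 K)} = ⊤ := by
    by_contra hne
    obtain ⟨M, hM, hle⟩ := Ideal.exists_le_maximal _ hne
    have hlM : (ℓ : 𝓞 K) ∈ M := hle (Ideal.mem_sup_right (Ideal.mem_span_singleton_self _))
    have hl0 : (ℓ : 𝓞 K) ≠ 0 := by exact_mod_cast (Fact.out : ℓ.Prime).ne_zero
    let v : HeightOneSpectrum (𝓞 K) := ⟨M, hM.isPrime, fun h => hl0 (by rwa [h] at hlM)⟩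
    obtain ⟨n, d, hnd⟩ := v.exists_primeCompl_mul_eq_of_integer t (ht v hlM)
    refine d.2 (hle (Ideal.mem_sup_left ⟨n, ?_⟩))
    rw [mul_comm]
    exact hnd
  obtain ⟨b, ⟨s, hs⟩, c, hc, hbc⟩ := Submodule.mem_sup.1 ((Ideal.eq_top_iff_one _).1 htop)
  obtain ⟨d, rfl⟩ := Ideal.mem_span_singleton.1 hc
  exact ⟨b, -d, s, by rw [← hbc]; ring, hs⟩

theorem exists_unit_of_dvd_sub_one {a : ℤ} (h : (ℓ : ℤ) ∣ a - 1) :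
    ∃ u : ℤ_[ℓ]ˣ, (u : ℤ_[ℓ]) = a := by
  have h1 : IsUnit (a : ℤ_[ℓ]) := by
    rw [PadicInt.isUnit_iff]
    refine le_antisymm (PadicInt.norm_le_one _) (not_lt.1 fun hlt => ?_)
    rw [PadicInt.norm_int_lt_one_iff_dvd] at hlt
    have h2 := dvd_sub hlt h
    rw [sub_sub_cancel] at h2
    exact (Nat.prime_iff_prime_int.1 (Fact.out : ℓ.Prime)).not_isUnit (isUnit_of_dvd_one h2)
  exact ⟨h1.unit, rfl⟩

/-- The image in `ℚ_ℓ^×` of the norm `N_{K/ℚ}`. -/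
def padicNormMap : Kˣ →* ℚ_[ℓ]ˣ :=
  Units.map ((algebraMap ℚ ℚ_[ℓ]).toMonoidHom.comp (Algebra.norm ℚ (S := K)))

theorem normLog_ofUnit (x : Kˣ) :
    normLog ℓ (ofUnit ℓ x) = iwasawaLog ℓ (Additive.ofMul (padicNormMap ℓ x)) := by
  rw [ofUnit, normLog_tmul, one_mul]; rfl

/-- If `z` is close to `1` at the places above `ℓ`, then `Log (N z)` is small. -/
theorem pow_dvd_normLog_of_near_one {m : ℕ} (hm : 0 < m) (z : Kˣ) (t : K)
    (hz : (z : K) = 1 + (ℓ : K) ^ m * t)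
    (ht : ∀ v : HeightOneSpectrum (𝓞 K), Above ℓ K v → v.valuation K t ≤ 1) :
    (ℓ : ℤ_[ℓ]) ^ m ∣ normLog ℓ (ofUnit ℓ z) := by
  obtain ⟨b, d, s, hb, hs⟩ := exists_denominator ℓ t ht
  have h1 := dvd_norm_sub_one_of_sub_one hb
  have h2 := dvd_norm_add_mul_sub_norm (ℓ ^ m) b s
  have h3 : (ℓ : ℤ) ∣ Algebra.norm ℤ (b + (ℓ ^ m : ℕ) * s) - 1 := by
    have h4 : (ℓ : ℤ) ∣ ((ℓ ^ m : ℕ) : ℤ) := by exact_mod_cast dvd_pow_self ℓ hm.ne'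
    simpa using dvd_add (h4.trans h2) h1
  obtain ⟨u, hu⟩ := exists_unit_of_dvd_sub_one ℓ h1
  obtain ⟨w, hw⟩ := exists_unit_of_dvd_sub_one ℓ h3
  have hzb : (z : K) * b = ((b + (ℓ ^ m : ℕ) * s : 𝓞 K) : K) := by
    have h5 : ((b + (ℓ ^ m : ℕ) * s : 𝓞 K) : K) = b + (ℓ : K) ^ m * s := by push_cast; rfl
    rw [hz, h5]
    linear_combination (ℓ : K) ^ m * hs
  have hnorm : (padicNormMap ℓ z : ℚ_[ℓ]) * ((u : ℤ_[ℓ]) : ℚ_[ℓ]) = ((w : ℤ_[ℓ]) : ℚ_[ℓ]) := by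
    have h5 := congrArg (fun q => algebraMap ℚ ℚ_[ℓ] (Algebra.norm ℚ q)) hzb
    simp only [map_mul] at h5
    rw [← Algebra.coe_norm_int, ← Algebra.coe_norm_int] at h5
    rw [hu, hw]
    simpa [padicNormMap] using h5
  have hval : (padicNormMap ℓ z : ℚ_[ℓ]) = ((w * u⁻¹ : ℤ_[ℓ]ˣ) : ℤ_[ℓ]) := by
    have hu0 : ((u : ℤ_[ℓ]) : ℚ_[ℓ]) ≠ 0 := by
      rw [Ne, PadicInt.coe_eq_zero]; exact u.ne_zero
    rw [eq_comm, ← mul_left_inj' hu0, hnorm, ← PadicInt.coe_mul, ← Units.val_mul,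
      inv_mul_cancel_right]
  rw [normLog_ofUnit, iwasawaLog_of_norm_eq_one ℓ _ _ hval]
  apply pow_dvd_unitLog ℓ hm
  have h6 : ((w * u⁻¹ : ℤ_[ℓ]ˣ) : ℤ_[ℓ]) - 1 = ((w : ℤ_[ℓ]) - u) * ((u⁻¹ : ℤ_[ℓ]ˣ) : ℤ_[ℓ]) := by
    rw [sub_mul, Units.mul_inv, Units.val_mul]
  rw [h6, hu, hw]
  refine Dvd.dvd.mul_right ?_ _
  have h7 := (Int.castRingHom ℤ_[ℓ]).map_dvd h2
  simpa using h7

end NormCongruence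

section Approximation
variable (ℓ : ℕ) [Fact ℓ.Prime] {K : Type*} [Field K] [NumberField K]

theorem finite_above : Finite {v : HeightOneSpectrum (𝓞 K) // Above ℓ K v} := by
  have hl0 : Ideal.span {(ℓ : 𝓞 K)} ≠ 0 := by
    have : (ℓ : 𝓞 K) ≠ 0 := by exact_mod_cast (Fact.out : ℓ.Prime).ne_zero
    simpa using this
  refine Set.Finite.subset (Ideal.finite_factors hl0) fun v hv => ?_
  exact Ideal.dvd_span_singleton.2 hv

theorem not_isEquiv_adicAbv {v w : HeightOneSpectrum (𝓞 K)} (h : v ≠ w) :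
    ¬ (HeightOneSpectrum.adicAbv K v).IsEquiv (HeightOneSpectrum.adicAbv K w) := by
  intro he
  apply h
  refine HeightOneSpectrum.ext (v.isMaximal.eq_of_le w.isPrime.ne_top fun x hx => ?_)
  have h1 := (v.adicAbv_coe_lt_one_iff (K := K) (HeightOneSpectrum.one_lt_absNorm_nnreal v) x).2 hx
  exact (w.adicAbv_coe_lt_one_iff (K := K) (HeightOneSpectrum.one_lt_absNorm_nnreal w) x).1
    (he.lt_one_iff.1 h1)

theorem isNontrivial_adicAbv (v : HeightOneSpectrum (𝓞 K)) :
    (HeightOneSpectrum.adicAbv K v).IsNontrivial := by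
  obtain ⟨x, hx, hx0⟩ := Submodule.exists_mem_ne_zero_of_ne_bot v.ne_bot
  refine ⟨x, by exact_mod_cast hx0, ?_⟩
  exact ((v.adicAbv_coe_lt_one_iff (K := K) (HeightOneSpectrum.one_lt_absNorm_nnreal v) x).2 hx).ne

/-- Weak approximation at the places above `ℓ`. -/
theorem exists_approx (U : ∀ v : {v : HeightOneSpectrum (𝓞 K) // Above ℓ K v},
      Set (v.1.adicCompletion K))
    (hU : ∀ v, IsOpen (U v)) (hne : ∀ v, (U v).Nonempty) :
    ∃ y : K, ∀ v, algebraMap K (v.1.adicCompletion K) y ∈ U v := by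
  have := finite_above ℓ (K := K)
  have h1 : ∀ v, ∃ z : K, algebraMap K (v.1.adicCompletion K) z ∈ U v := fun v =>
    (v.1.denseRange_algebraMap K).exists_mem_open (hU v) (hne v)
  choose z hz using h1
  have h2 : ∀ v, ∃ ε > 0, Metric.ball (algebraMap K (v.1.adicCompletion K) (z v)) ε ⊆ U v := fun v =>
    Metric.isOpen_iff.1 (hU v) _ (hz v)
  choose ε hε hball using h2
  have hdense := AbsoluteValue.denseRange_algebraMap_pi
    (v := fun v : {v : HeightOneSpectrum (𝓞 K) // Above ℓ K v} => HeightOneSpectrum.adicAbv K v.1)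
    (fun v => isNontrivial_adicAbv v.1) (fun v w h => not_isEquiv_adicAbv fun he => h (Subtype.ext he))
  let O : Set (∀ v : {v : HeightOneSpectrum (𝓞 K) // Above ℓ K v},
      WithAbs (HeightOneSpectrum.adicAbv K v.1)) :=
    Set.univ.pi fun v => Metric.ball (WithAbs.toAbs _ (z v)) (ε v)
  obtain ⟨y, hy⟩ := hdense.exists_mem_open (s := O)
    (isOpen_set_pi Set.finite_univ fun v _ => Metric.isOpen_ball)
    ⟨fun v => WithAbs.toAbs _ (z v), fun v _ => Metric.mem_ball_self (hε v)⟩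
  refine ⟨y, fun v => hball v ?_⟩
  have h3 := hy v trivial
  rw [mem_ball_iff_norm] at h3 ⊢
  rw [← map_sub]
  refine lt_of_eq_of_lt ?_ h3
  exact FinitePlace.norm_embedding v.1 (y - z v)

/-- If `x` is an `ℓ ^ n`-th power in `K_v` for all `v` above `ℓ`, then `Log (N x)` is divisible by
`ℓ ^ n`: weak approximation gives `s` in `K^×` such that `x / s ^ (ℓ ^ n)` is close to `1`. -/
theorem pow_dvd_normLog_of_local_pow (n : ℕ) (x : Kˣ)
    (hx : ∀ v : HeightOneSpectrum (𝓞 K), Above ℓ K v → ∃ y : (v.adicCompletion K)ˣ,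
      algebraMap K (v.adicCompletion K) x = (y : v.adicCompletion K) ^ ℓ ^ n) :
    (ℓ : ℤ_[ℓ]) ^ n ∣ normLog ℓ (ofUnit ℓ x) := by
  have hl0 : (ℓ : K) ≠ 0 := by exact_mod_cast (Fact.out : ℓ.Prime).ne_zero
  choose! y hy using hx
  let g : ∀ v : {v : HeightOneSpectrum (𝓞 K) // Above ℓ K v}, v.1.adicCompletion K → ℝ :=
    fun v s => ‖(algebraMap K (v.1.adicCompletion K) x / s ^ ℓ ^ n - 1) /
      algebraMap K (v.1.adicCompletion K) ((ℓ : K) ^ (n + 1))‖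
  have hg : ∀ v, ∀ᶠ s in 𝓝 (y v.1 : v.1.adicCompletion K), g v s < 1 ∧ s ≠ 0 := by
    intro v
    have hy0 : (y v.1 : v.1.adicCompletion K) ^ ℓ ^ n ≠ 0 := pow_ne_zero _ (y v.1).ne_zero
    have hc : ContinuousAt (g v) (y v.1 : v.1.adicCompletion K) :=
      ((((continuousAt_const.div (continuousAt_id.pow _) hy0).sub continuousAt_const).div_const
        _)).norm
    refine (hc.eventually_lt continuousAt_const ?_).and
      (continuousAt_id.eventually_ne (y v.1).ne_zero)
    simp only [g]
    rw [hy v.1 v.2, div_self hy0, sub_self, zero_div, norm_zero]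
    exact one_pos
  obtain ⟨s, hs⟩ := exists_approx ℓ (K := K)
    (fun v => interior {s | g v s < 1 ∧ s ≠ 0}) (fun v => isOpen_interior)
    (fun v => ⟨_, mem_interior_iff_mem_nhds.2 (hg v)⟩)
  obtain ⟨s, hs⟩ : ∃ s : Kˣ, ∀ v, g v (algebraMap K (v.1.adicCompletion K) s) < 1 := by
    by_cases hs0 : s = 0
    · exact ⟨1, fun v => absurd (by rw [hs0, map_zero]) (interior_subset (hs v)).2⟩
    · exact ⟨Units.mk0 s hs0, fun v => (interior_subset (hs v)).1⟩
  let z : Kˣ := x * (s ^ ℓ ^ n)⁻¹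
  have hz : (z : K) = 1 + (ℓ : K) ^ (n + 1) * (((x : K) / (s : K) ^ ℓ ^ n - 1) / (ℓ : K) ^ (n + 1)) := by
    rw [mul_div_cancel₀ _ (pow_ne_zero _ hl0), add_sub_cancel, div_eq_mul_inv]
    simp [z]
  have hzlog := pow_dvd_normLog_of_near_one ℓ n.succ_pos z _ hz (fun v hv => by
    rw [← WithZeroMulInt.toNNReal_le_one_iff (HeightOneSpectrum.one_lt_absNorm_nnreal v),
      ← NNReal.coe_le_coe, NNReal.coe_one]
    refine le_trans (le_of_eq (FinitePlace.norm_embedding' v _).symm) ?_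
    have h1 := (hs ⟨v, hv⟩).le
    simp only [g] at h1
    rw [← map_pow, ← map_div₀, ← map_one (algebraMap K (v.adicCompletion K)), ← map_sub,
      ← map_div₀] at h1
    exact h1)
  have hxz : x = z * s ^ ℓ ^ n := by simp [z]
  rw [hxz, ofUnit_mul, ofUnit_pow, map_add, map_nsmul, nsmul_eq_mul]
  refine dvd_add ((pow_dvd_pow _ n.le_succ).trans hzlog) ?_
  push_cast
  exact dvd_mul_right _ _

/-- A common multiple of a pseudo-infinitesimal element is infinitely `ℓ`-divisible at all the places
above `ℓ`. -/
theorem exists_nsmul_divisible_of_mem_pseudoInf {x : AdicUnits ℓ K} (hx : x ∈ pseudoInf ℓ K) :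
    ∃ M : ℕ, 0 < M ∧ ∀ v : HeightOneSpectrum (𝓞 K), Above ℓ K v → ∀ n : ℕ, ∃ w,
      AdicUnits.map ℓ (algebraMap K (v.adicCompletion K)) (M • x) = (ℓ : ℤ_[ℓ]) ^ n • w := by
  rw [mem_pseudoInf_iff] at hx
  have := finite_above ℓ (K := K)
  have := Fintype.ofFinite {v : HeightOneSpectrum (𝓞 K) // Above ℓ K v}
  choose! N hN h using hx
  refine ⟨∏ v : {v : HeightOneSpectrum (𝓞 K) // Above ℓ K v}, N v.1,
    Finset.prod_pos fun v _ => hN v.1 v.2, fun v hv n => ?_⟩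
  obtain ⟨c, hc⟩ := Finset.dvd_prod_of_mem (fun v : {v : HeightOneSpectrum (𝓞 K) // Above ℓ K v} =>
    N v.1) (Finset.mem_univ ⟨v, hv⟩)
  obtain ⟨u, hu⟩ := h v hv n
  refine ⟨c • u, ?_⟩
  rw [map_nsmul, smul_comm, ← hu, ← mul_smul, mul_comm]
  exact congrArg (· • _) hc

/-- The pseudo-infinitesimal elements have norm of logarithm zero. -/
theorem normLog_eq_zero_of_mem_pseudoInf {x : AdicUnits ℓ K} (hx : x ∈ pseudoInf ℓ K) :
    normLog ℓ x = 0 := by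
  obtain ⟨M, hM, h⟩ := exists_nsmul_divisible_of_mem_pseudoInf ℓ hx
  have hMx : normLog ℓ (M • x) = 0 := by
    refine eq_zero_of_forall_pow_dvd ℓ _ fun n => ?_
    -- Modulo `ℓ ^ n` the element `M • x` comes from some `a` in `K^×`, a local `ℓ ^ n`-th power.
    obtain ⟨a, w, haw⟩ := exists_eq_tmul_add_pow_smul ℓ n (M • x)
    rw [haw, map_add, map_smul, smul_eq_mul]
    refine dvd_add (pow_dvd_normLog_of_local_pow ℓ n a.toMul fun v hv => ?_) (dvd_mul_right _ _)
    obtain ⟨u, hu⟩ := h v hv n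
    have h2 : ofUnit ℓ (Units.map (algebraMap K (v.adicCompletion K)).toMonoidHom a.toMul) =
        (ℓ : ℤ_[ℓ]) ^ n • (u - AdicUnits.map ℓ (algebraMap K (v.adicCompletion K)) w) := by
      rw [smul_sub, ← hu, haw, map_add, map_smul, add_sub_cancel_right]
      rfl
    obtain ⟨b, hb⟩ := exists_eq_pow_nsmul_of_tmul ℓ n _ _ h2
    exact ⟨b.toMul, congrArg Units.val hb⟩
  rw [map_nsmul, nsmul_eq_mul, mul_eq_zero, Nat.cast_eq_zero, or_iff_right hM.ne'] at hMx
  exact hMx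

/-- Away from `ℓ`, the logarithmic degree is `Log (N v)`, so that the degree of a divisor prime to `ℓ` is
given by the product formula. -/
theorem logDivDeg_eq_normLog {a : Divisor ℓ K} (ha : a ∈ primeToDiv ℓ K) {x : AdicUnits ℓ K}
    (hx : ∀ v, a v = ord ℓ v x) : logDivDeg ℓ K a = normLog ℓ x := by
  have h : a = adicDiv ℓ x := Finsupp.ext fun v => by rw [hx, adicDiv_apply]
  rw [normLog_eq, ← h, logDivDeg, Finsupp.linearCombination_apply, Finsupp.linearCombination_apply]
  refine Finsupp.sum_congr fun v hv => ?_
  rw [logDeg_of_not_above ℓ ((Finsupp.mem_supported _ _).1 ha hv)]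

end Approximation

/-! ### Units, and the consequence of the Leopoldt conjecture -/

section Units
variable (ℓ : ℕ) [Fact ℓ.Prime] {K : Type*} [Field K] [NumberField K]

/-- The inclusion `E_K → K^×` of the units, written additively. -/
abbrev unitsIncl (K : Type*) [Field K] : Additive (𝓞 K)ˣ →ₗ[ℤ] Additive Kˣ :=
  (Units.map (algebraMap (𝓞 K) K).toMonoidHom).toAdditive.toIntLinearMap

theorem exact_unitsIncl_intDiv :
    Function.Exact (unitsIncl K) (intDiv (K := K)).toIntLinearMap := by
  intro x
  constructor
  · intro h
    have hval : ∀ v : HeightOneSpectrum (𝓞 K), v.valuation K (x.toMul : K) = 1 := by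
      intro v
      have h1 : intDiv (Additive.ofMul x.toMul) v = 0 := DFunLike.congr_fun h v
      rw [intDiv_apply, neg_eq_zero] at h1
      rw [← HeightOneSpectrum.valuationOfNeZero_eq]
      exact congrArg _ h1
    obtain ⟨a, ha⟩ := HeightOneSpectrum.mem_integers_of_valuation_le_one K (x.toMul : K)
      fun v => (hval v).le
    obtain ⟨b, hb⟩ := HeightOneSpectrum.mem_integers_of_valuation_le_one K ((x.toMul)⁻¹ : K)
      fun v => by rw [map_inv₀, hval, inv_one]
    have hab : a * b = 1 := by
      apply RingOfIntegers.coe_injective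
      have h2 : algebraMap (𝓞 K) K (a * b) = algebraMap (𝓞 K) K 1 := by
        rw [map_mul, ha, hb, map_one, mul_inv_cancel₀ x.toMul.ne_zero]
      exact h2
    exact ⟨Additive.ofMul (Units.mkOfMulEqOne a b hab), Units.ext ha⟩
  · rintro ⟨u, rfl⟩
    refine Finsupp.ext fun v => ?_
    refine (intDiv_apply (Units.map (algebraMap (𝓞 K) K).toMonoidHom u.toMul) v).trans ?_
    exact neg_eq_zero.2 (congrArg Multiplicative.toAdd (v.valuation_of_unit_eq (K := K) u.toMul))

/-- The elements of `ℤ_ℓ ⊗ K^×` with trivial divisor come from `ℤ_ℓ ⊗ E_K`. -/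
theorem exists_unit_of_ord_eq_zero (x : AdicUnits ℓ K) (hx : ∀ v, ord ℓ v x = 0) :
    ∃ u : ℤ_[ℓ] ⊗[ℤ] Additive (𝓞 K)ˣ, (unitsIncl K).baseChange ℤ_[ℓ] u = x := by
  classical
  refine (baseChange_exact ℓ exact_unitsIncl_intDiv x).1 ?_
  apply (TensorProduct.finsuppScalarRight ℤ ℤ_[ℓ] ℤ_[ℓ] (HeightOneSpectrum (𝓞 K))).injective
  rw [map_zero]
  refine Finsupp.ext fun v => ?_
  rw [Finsupp.zero_apply, ← hx v]
  clear hx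
  induction x using TensorProduct.induction_on with
  | zero => simp
  | add x y hx hy => simp only [map_add, Finsupp.add_apply, hx, hy]
  | tmul c a =>
    refine Eq.trans ?_ (ord_tmul v c a.toMul).symm
    rw [LinearMap.baseChange_tmul, TensorProduct.finsuppScalarRight_apply_tmul_apply, zsmul_eq_mul,
      mul_comm]
    rfl

/-- Under the Leopoldt conjecture, a pseudo-infinitesimal element with trivial divisor is a root of
unity: it is a unit, and a multiple of it is locally trivial above `ℓ`. -/
theorem exists_rootOfUnity_of_leopoldt (hLeo : Leopoldt ℓ K) {x : AdicUnits ℓ K}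
    (hx : x ∈ pseudoInf ℓ K) (h0 : ∀ v, ord ℓ v x = 0) :
    ∃ (ζ : Kˣ) (k : ℕ), ζ ^ ℓ ^ k = 1 ∧ x = ofUnit ℓ ζ := by
  obtain ⟨u, rfl⟩ := exists_unit_of_ord_eq_zero ℓ x h0
  obtain ⟨M, hM, h⟩ := exists_nsmul_divisible_of_mem_pseudoInf ℓ hx
  have hMu : M • u = 0 := hLeo _ fun v hv => by
    rw [loc, LinearMap.comp_apply, toProAdic_eq_zero_iff, map_nsmul]
    exact h v hv
  obtain ⟨k, e, he⟩ := exists_pow_mul_unit ℓ hM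
  have hku : (ℓ : ℤ_[ℓ]) ^ k • u = 0 := by
    rw [← Nat.cast_smul_eq_nsmul ℤ_[ℓ], he, mul_smul] at hMu
    exact (e.isUnit.smul_eq_zero).1 hMu
  obtain ⟨ε, hε, rfl⟩ := exists_eq_tmul_of_pow_smul_eq_zero ℓ k u hku
  refine ⟨Units.map (algebraMap (𝓞 K) K).toMonoidHom ε.toMul, k, ?_, rfl⟩
  rw [← map_pow]
  exact (congrArg _ (show ε.toMul ^ ℓ ^ k = 1 from hε)).trans (map_one _)

end Units

/-! ### Galois action and descent -/

section Galois
variable (ℓ : ℕ) [Fact ℓ.Prime] {K L : Type*} [Field K] [Field L] [Algebra K L]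

/-- The action of an automorphism of `L / K` on `ℤ_ℓ ⊗ L^×`. -/
abbrev galMap (σ : Gal(L/K)) : AdicUnits ℓ L →ₗ[ℤ_[ℓ]] AdicUnits ℓ L :=
  AdicUnits.map ℓ (σ : L →+* L)

theorem galMap_map (σ : Gal(L/K)) (x : AdicUnits ℓ K) :
    galMap ℓ σ (AdicUnits.map ℓ (algebraMap K L) x) = AdicUnits.map ℓ (algebraMap K L) x := by
  rw [AdicUnits.map_map]
  congr 2
  exact RingHom.ext fun x => σ.commutes x

theorem galMap_galMap (σ τ : Gal(L/K)) (x : AdicUnits ℓ L) :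
    galMap ℓ σ (galMap ℓ τ x) = galMap ℓ (σ * τ) x := by
  rw [AdicUnits.map_map]
  rfl

theorem mem_range_of_generator_fixed [FiniteDimensional K L] [IsGalois K L] {σ : Gal(L/K)}
    (hσ : ∀ τ, τ ∈ Subgroup.zpowers σ) {y : L} (hy : σ y = y) : y ∈ Set.range (algebraMap K L) := by
  rw [IsGalois.mem_range_algebraMap_iff_fixed]
  intro τ
  have h : Subgroup.zpowers σ ≤ MulAction.stabilizer Gal(L/K) y := by
    rw [Subgroup.zpowers_le]
    exact hy
  exact h (hσ τ)

/-- Galois descent for `ℤ_ℓ ⊗ L^×`: tensor the exact sequence `1 → K^× → L^× → L^×` given by `σ - 1` with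
the flat module `ℤ_ℓ`. -/
theorem exists_map_of_galMap_eq [FiniteDimensional K L] [IsGalois K L] {σ : Gal(L/K)}
    (hσ : ∀ τ, τ ∈ Subgroup.zpowers σ) {x : AdicUnits ℓ L} (hx : galMap ℓ σ x = x) :
    ∃ z : AdicUnits ℓ K, AdicUnits.map ℓ (algebraMap K L) z = x := by
  let f : Additive Kˣ →ₗ[ℤ] Additive Lˣ :=
    (Units.map (algebraMap K L).toMonoidHom).toAdditive.toIntLinearMap
  let s : Additive Lˣ →ₗ[ℤ] Additive Lˣ :=
    (Units.map (σ : L →+* L).toMonoidHom).toAdditive.toIntLinearMap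
  have hex : Function.Exact f (s - (LinearMap.id : Additive Lˣ →ₗ[ℤ] Additive Lˣ)) := by
    intro y
    rw [LinearMap.sub_apply, sub_eq_zero, LinearMap.id_apply]
    constructor
    · intro h
      have h1 : σ (y.toMul : L) = y.toMul := congrArg Units.val h
      obtain ⟨z, hz⟩ := mem_range_of_generator_fixed hσ h1
      have hz0 : z ≠ 0 := by
        rintro rfl
        rw [map_zero] at hz
        exact y.toMul.ne_zero hz.symm
      exact ⟨Additive.ofMul (Units.mk0 z hz0), Units.ext hz⟩
    · rintro ⟨z, rfl⟩
      exact Units.ext (σ.commutes z.toMul)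
  refine (baseChange_exact ℓ hex x).1 ?_
  have hid := LinearMap.baseChange_id (R := ℤ) (A := ℤ_[ℓ]) (M := Additive Lˣ)
  rw [LinearMap.baseChange_sub, hid, LinearMap.sub_apply, LinearMap.id_apply, sub_eq_zero]
  exact hx

variable [NumberField K] [NumberField L]

omit [NumberField K] in
theorem galMap_mem_pseudoInf (σ : Gal(L/K)) {x : AdicUnits ℓ L} (hx : x ∈ pseudoInf ℓ L) :
    galMap ℓ σ x ∈ pseudoInf ℓ L :=
  -- `σ` is the structural map of a structure of `L`-algebra on `L`.
  @map_mem_pseudoInf ℓ _ L L _ _ _ _ (σ : L →+* L).toAlgebra x hx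

/-- An element whose divisor is extended from `K` has the same divisor as its conjugates. -/
theorem ord_galMap_of_ext (σ : Gal(L/K)) {x : AdicUnits ℓ L} (a : HeightOneSpectrum (𝓞 K) → ℤ_[ℓ])
    (hx : ∀ w : HeightOneSpectrum (𝓞 L), ord ℓ w x =
      (Ideal.ramificationIdx' (w.under (𝓞 K)).asIdeal w.asIdeal : ℤ_[ℓ]) * a (w.under (𝓞 K)))
    (w : HeightOneSpectrum (𝓞 L)) : ord ℓ w (galMap ℓ σ x) = ord ℓ w x := by
  -- For the structure of `L`-algebra on `L` given by `σ`, the place below `w` is `σ⁻¹ w`.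
  obtain ⟨w', e, hunder, he⟩ : ∃ (w' : HeightOneSpectrum (𝓞 L)) (e : ℤ_[ℓ]),
      w'.under (𝓞 K) = w.under (𝓞 K) ∧
      ∀ z : AdicUnits ℓ L, ord ℓ w (galMap ℓ σ z) = e * ord ℓ w' z := by
    refine ⟨_, _, ?_, fun z => @ord_map ℓ _ L L _ _ _ _ (σ : L →+* L).toAlgebra w z⟩
    refine HeightOneSpectrum.ext (Ideal.ext fun x => ?_)
    have h : @algebraMap (𝓞 L) (𝓞 L) _ _
        (@NumberField.inst_ringOfIntegersAlgebra L L _ _ (σ : L →+* L).toAlgebra)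
        (algebraMap (𝓞 K) (𝓞 L) x) = algebraMap (𝓞 K) (𝓞 L) x :=
      RingOfIntegers.ext (σ.commutes (x : K))
    change _ ∈ w.asIdeal ↔ _ ∈ w.asIdeal
    rw [h]
  -- Comparing on a uniformizer of `K` shows `e * e(w'|v) = e(w|v)`.
  obtain ⟨π, hπ⟩ := (w.under (𝓞 K)).valuation_exists_uniformizer K
  have hπ0 : π ≠ 0 := by
    rintro rfl
    rw [map_zero] at hπ
    exact WithZero.coe_ne_zero hπ.symm
  have hord : ord ℓ (w.under (𝓞 K)) (ofUnit ℓ (Units.mk0 π hπ0)) = 1 := by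
    have h1 := HeightOneSpectrum.valuationOfNeZero_eq (w.under (𝓞 K)) (Units.mk0 π hπ0)
    rw [Units.val_mk0, hπ] at h1
    rw [ord_ofUnit, WithZero.coe_injective h1]
    simp
  have h2 := he (AdicUnits.map ℓ (algebraMap K L) (ofUnit ℓ (Units.mk0 π hπ0)))
  rw [galMap_map, ord_map, ord_map, hunder, hord, mul_one, mul_one] at h2
  rw [he, hx, hx, hunder, ← mul_assoc, ← h2]

end Galois

/-! ### Kummer theory of a cyclic extension of prime degree -/

section Kummer
variable {ℓ : ℕ} [Fact ℓ.Prime] {K L : Type*} [Field K] [Field L] [Algebra K L]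
  [FiniteDimensional K L] [IsGalois K L] {σ : Gal(L/K)}

omit [FiniteDimensional K L] [IsGalois K L] in
theorem mem_range_of_pow_eq_one (hμ : ∃ ζ : K, IsPrimitiveRoot ζ ℓ) {x : L} (hx : x ^ ℓ = 1) :
    x ∈ Set.range (algebraMap K L) := by
  obtain ⟨ζ, hζ⟩ := hμ
  have : NeZero ℓ := ⟨(Fact.out : ℓ.Prime).ne_zero⟩
  obtain ⟨i, -, hi⟩ := (hζ.map_of_injective (algebraMap K L).injective).eq_pow_of_pow_eq_one hx
  exact ⟨ζ ^ i, by rw [map_pow, hi]⟩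

/-- Such a `ξ` satisfies `σ ξ = ω ξ` with `ω ^ ℓ = 1`, whence `1 = N ξ = ω ^ (ℓ (ℓ - 1) / 2) ξ ^ ℓ = ξ ^ ℓ`
as `ℓ` is odd. -/
theorem mem_range_of_pow_mem_range (hσ : ∀ τ, τ ∈ Subgroup.zpowers σ) (hℓ : ℓ ≠ 2)
    (hμ : ∃ ζ : K, IsPrimitiveRoot ζ ℓ) (hdeg : Module.finrank K L = ℓ) {ξ : L}
    (hnorm : Algebra.norm K ξ = 1) (hpow : ξ ^ ℓ ∈ Set.range (algebraMap K L)) :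
    ξ ∈ Set.range (algebraMap K L) := by
  have hcard : Nat.card Gal(L/K) = ℓ := by rw [IsGalois.card_aut_eq_finrank, hdeg]
  have hξ0 : ξ ≠ 0 := by
    rintro rfl
    rw [Algebra.norm_zero] at hnorm
    exact zero_ne_one hnorm
  have hω : (σ ξ / ξ) ^ ℓ = 1 := by
    obtain ⟨c, hc⟩ := hpow
    rw [div_pow, ← map_pow, ← hc, σ.commutes, hc, div_self (pow_ne_zero _ hξ0)]
  obtain ⟨ω, hωK⟩ := mem_range_of_pow_eq_one hμ hω
  have hσξ : σ ξ = algebraMap K L ω * ξ := by rw [hωK, div_mul_cancel₀ _ hξ0]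
  have hσi : ∀ i : ℕ, (σ ^ i) ξ = algebraMap K L ω ^ i * ξ := by
    intro i
    induction i with
    | zero => simp
    | succ i ih =>
      rw [pow_succ, AlgEquiv.mul_apply, hσξ, map_mul, AlgEquiv.commutes, ih]
      ring
  apply mem_range_of_pow_eq_one hμ
  classical
  have h1 := Algebra.norm_eq_prod_automorphisms K ξ
  rw [hnorm, map_one, ← IsCyclic.image_range_card hσ, Finset.prod_image, hcard] at h1
  · simp_rw [hσi] at h1
    rw [Finset.prod_mul_distrib, Finset.prod_const, Finset.card_range, Finset.prod_pow_eq_pow_sum,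
      Finset.sum_range_id] at h1
    obtain ⟨m, hm⟩ : 2 ∣ ℓ - 1 := by
      have := (Fact.out : ℓ.Prime).eq_two_or_odd
      omega
    have h2 : ℓ * (ℓ - 1) / 2 = ℓ * m := by
      rw [hm, mul_left_comm, Nat.mul_div_cancel_left _ two_pos]
    rw [h2, pow_mul, hωK, hω, one_pow, one_mul] at h1
    exact h1.symm
  · intro i hi j hj hij
    rw [← orderOf_eq_card_of_forall_mem_zpowers hσ] at hi hj
    exact pow_injOn_Iio_orderOf (by simpa using hi) (by simpa using hj) hij

/-- A root of unity of `ℓ`-power order and of norm `1` lies in the base field: otherwise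
`mem_range_of_pow_mem_range` applies to the last `ζ ^ ℓ ^ i` which is not in `K`. -/
theorem mem_range_of_norm_eq_one (hσ : ∀ τ, τ ∈ Subgroup.zpowers σ) (hℓ : ℓ ≠ 2)
    (hμ : ∃ ζ : K, IsPrimitiveRoot ζ ℓ) (hdeg : Module.finrank K L = ℓ) {ζ : L} {k : ℕ}
    (hζ : ζ ^ ℓ ^ k = 1) (hnorm : Algebra.norm K ζ = 1) : ζ ∈ Set.range (algebraMap K L) := by
  induction k generalizing ζ with
  | zero => exact ⟨1, by simpa using hζ.symm⟩
  | succ k ih =>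
    refine mem_range_of_pow_mem_range hσ hℓ hμ hdeg hnorm (ih ?_ ?_)
    · rw [← pow_mul, ← pow_succ', hζ]
    · rw [map_pow, hnorm, one_pow]

omit [FiniteDimensional K L] [IsGalois K L] in
theorem adjoin_eq_top_of_not_mem (hdeg : Module.finrank K L = ℓ) {y : L}
    (hy : y ∉ Set.range (algebraMap K L)) : IntermediateField.adjoin K {y} = ⊤ := by
  have := IntermediateField.isSimpleOrder_of_finrank_prime K L (hdeg ▸ (Fact.out : ℓ.Prime))
  refine (eq_bot_or_eq_top _).resolve_left fun h => hy ?_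
  rw [IntermediateField.adjoin_simple_eq_bot_iff] at h
  exact IntermediateField.mem_bot.1 h

/-- If `σ x - x` is a root of unity of `ℓ`-power order, then it is an `ℓ`-th root of unity: it has norm
`1`, so it lies in `K`, where the norm is `ζ ^ ℓ`. -/
theorem rootOfUnity_pow_eq_one (hσ : ∀ τ, τ ∈ Subgroup.zpowers σ) (hℓ : ℓ ≠ 2)
    (hμ : ∃ ζ : K, IsPrimitiveRoot ζ ℓ) (hdeg : Module.finrank K L = ℓ) {x : AdicUnits ℓ L}
    {ζ : Lˣ} {k : ℕ} (hζ : ζ ^ ℓ ^ k = 1) (hx : galMap ℓ σ x = x + ofUnit ℓ ζ) :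
    (ζ : L) ^ ℓ = 1 := by
  have hnorm : Algebra.norm K (ζ : L) = 1 := by
    -- The product `P` of the conjugates of `ζ` is `1`, as `∑ τ, τ (σ x - x) = 0`.
    let P : Lˣ := ∏ τ : Gal(L/K), Units.map (τ : L →+* L).toMonoidHom ζ
    have hP : ofUnit ℓ P = 0 := by
      have h1 : ofUnit ℓ P = ∑ τ : Gal(L/K), galMap ℓ τ (ofUnit ℓ ζ) := by
        rw [ofUnit, ofMul_prod, TensorProduct.tmul_sum]
        rfl
      have h2 : ofUnit ℓ ζ = galMap ℓ σ x - x := by rw [hx, add_sub_cancel_left]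
      rw [h1, h2]
      simp_rw [map_sub, galMap_galMap]
      rw [Finset.sum_sub_distrib, sub_eq_zero]
      exact Fintype.sum_equiv (Equiv.mulRight σ) _ _ fun τ => rfl
    have hPk : P ^ ℓ ^ k = 1 := by
      simp_rw [P, ← Finset.prod_pow, ← map_pow, hζ, map_one, Finset.prod_const_one]
    have hP1 : P = 1 := eq_zero_of_tmul_eq_zero ℓ k (a := Additive.ofMul P) hPk hP
    apply (algebraMap K L).injective
    rw [Algebra.norm_eq_prod_automorphisms, map_one]
    have h3 := congrArg Units.val hP1
    rw [Units.coe_prod] at h3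
    exact h3
  obtain ⟨z, hz⟩ := mem_range_of_norm_eq_one hσ hℓ hμ hdeg
    (by rw [← Units.val_pow_eq_pow_val, hζ, Units.val_one]) hnorm
  rw [← hz, Algebra.norm_algebraMap, hdeg] at hnorm
  rw [← hz, ← map_pow, hnorm, map_one]

/-- A generator `y` of `L / K` with `y ^ ℓ` in `K` is an eigenvector of `σ` for a primitive `ℓ`-th root
of unity, so its powers are eigenvectors for all `ℓ`-th roots of unity. -/
theorem exists_pow_eigenvector (hσ : ∀ τ, τ ∈ Subgroup.zpowers σ)
    {y : L} (hy0 : y ≠ 0)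
    (hy : y ^ ℓ ∈ Set.range (algebraMap K L)) (hyK : y ∉ Set.range (algebraMap K L))
    {ζ : L} (hζ : ζ ^ ℓ = 1) : ∃ j : ℕ, σ (y ^ j) = ζ * y ^ j := by
  have hω : (σ y / y) ^ ℓ = 1 := by
    obtain ⟨c, hc⟩ := hy
    rw [div_pow, ← map_pow, ← hc, σ.commutes, hc, div_self (pow_ne_zero _ hy0)]
  have hω1 : σ y / y ≠ 1 := fun h =>
    hyK (mem_range_of_generator_fixed hσ ((div_eq_one_iff_eq hy0).1 h))
  have hprim : IsPrimitiveRoot (σ y / y) ℓ :=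
    orderOf_eq_prime hω hω1 ▸ IsPrimitiveRoot.orderOf (σ y / y)
  have : NeZero ℓ := ⟨(Fact.out : ℓ.Prime).ne_zero⟩
  obtain ⟨j, -, hj⟩ := hprim.eq_pow_of_pow_eq_one hζ
  refine ⟨j, ?_⟩
  rw [← hj, map_pow, div_pow, div_mul_cancel₀ _ (pow_ne_zero _ hy0)]

omit [FiniteDimensional K L] [IsGalois K L] in
theorem not_mem_range_of_adjoin_eq_top (hdeg : Module.finrank K L = ℓ) {y : L}
    (hy : IntermediateField.adjoin K {y} = ⊤) : y ∉ Set.range (algebraMap K L) := by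
  intro h
  rw [IntermediateField.adjoin_simple_eq_bot_iff.2 (IntermediateField.mem_bot.2 h)] at hy
  have h1 := IntermediateField.finrank_bot (F := K) (E := L)
  rw [hy, IntermediateField.finrank_top', hdeg] at h1
  exact (Fact.out : ℓ.Prime).one_lt.ne' h1

/-- If `σ x - x` is a root of unity `ζ ≠ 1`, then, up to an element of `ℤ_ℓ ⊗ K^×`, `x` is a Kummer
generator of `L / K`. -/
theorem exists_kummer_generator (hσ : ∀ τ, τ ∈ Subgroup.zpowers σ) (hℓ : ℓ ≠ 2)
    (hμ : ∃ ζ : K, IsPrimitiveRoot ζ ℓ) (hdeg : Module.finrank K L = ℓ) {x : AdicUnits ℓ L}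
    {ζ : Lˣ} (hζ1 : ζ ≠ 1) {k : ℕ} (hζ : ζ ^ ℓ ^ k = 1) (hx : galMap ℓ σ x = x + ofUnit ℓ ζ) :
    ∃ (y : Lˣ) (c : Kˣ) (γ : AdicUnits ℓ K), (y : L) ^ ℓ = algebraMap K L c ∧
      IntermediateField.adjoin K {(y : L)} = ⊤ ∧
      x = ofUnit ℓ y + AdicUnits.map ℓ (algebraMap K L) γ := by
  have hζℓ := rootOfUnity_pow_eq_one hσ hℓ hμ hdeg hζ hx
  have : IsCyclic Gal(L/K) := ⟨σ, hσ⟩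
  obtain ⟨y₀, hy₀, hy₀'⟩ := exists_root_adjoin_eq_top_of_isCyclic K L (by
    obtain ⟨ω, hω⟩ := hμ
    exact ⟨ω, (mem_primitiveRoots Module.finrank_pos).2 (hdeg ▸ hω)⟩)
  rw [hdeg] at hy₀
  have hy₀K := not_mem_range_of_adjoin_eq_top hdeg hy₀'
  have hy₀0 : y₀ ≠ 0 := fun h => hy₀K ⟨0, by rw [h, map_zero]⟩
  obtain ⟨j, hj⟩ := exists_pow_eigenvector hσ hy₀0 hy₀ hy₀K hζℓ
  obtain ⟨y, hy⟩ : ∃ y : Lˣ, (y : L) = y₀ ^ j := ⟨Units.mk0 _ (pow_ne_zero j hy₀0), rfl⟩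
  have hσy : σ (y : L) = ζ * (y : L) := by rw [hy, hj]
  have hpow : (y : L) ^ ℓ ∈ Set.range (algebraMap K L) := by
    apply mem_range_of_generator_fixed hσ
    rw [map_pow, hσy, mul_pow, hζℓ, one_mul]
  obtain ⟨c, hc⟩ := hpow
  have hc0 : c ≠ 0 := by
    rintro rfl
    rw [map_zero, eq_comm] at hc
    exact y.ne_zero (pow_eq_zero_iff (Fact.out : ℓ.Prime).ne_zero |>.1 hc)
  have hy : (y : L) ∉ Set.range (algebraMap K L) := by
    rintro ⟨z, hz⟩
    rw [← hz, σ.commutes, hz, eq_comm, mul_eq_right₀ y.ne_zero] at hσy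
    exact hζ1 (Units.ext hσy)
  have hfix : galMap ℓ σ (x - ofUnit ℓ y) = x - ofUnit ℓ y := by
    have h1 : galMap ℓ σ (ofUnit ℓ y) = ofUnit ℓ ζ + ofUnit ℓ y := by
      rw [← ofUnit_mul, AdicUnits.map_ofUnit]
      congr 2
      exact Units.ext hσy
    rw [map_sub, hx, h1]
    abel
  obtain ⟨γ, hγ⟩ := exists_map_of_galMap_eq ℓ hσ hfix
  exact ⟨y, Units.mk0 c hc0, γ, hc.symm, adjoin_eq_top_of_not_mem hdeg hy, by
    rw [hγ, add_sub_cancel]⟩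

end Kummer

/-! ### Capitulation -/

section Capitulation
variable {ℓ : ℕ} [Fact ℓ.Prime] {K L : Type*} [Field K] [NumberField K] [Field L] [NumberField L]
  [Algebra K L]

variable (L) in
omit [NumberField K] [NumberField L] in
theorem exists_place_over (v : HeightOneSpectrum (𝓞 K)) :
    ∃ w : HeightOneSpectrum (𝓞 L), w.under (𝓞 K) = v := by
  obtain ⟨⟨P, hP, hPv⟩⟩ := Ideal.nonempty_primesOver (S := 𝓞 L) v.asIdeal
  exact ⟨⟨P, hP, Ideal.ne_bot_of_liesOver_of_ne_bot v.ne_bot P⟩,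
    HeightOneSpectrum.ext hPv.over.symm⟩

theorem mem_pseudoInf_of_map {z : AdicUnits ℓ K}
    (hz : AdicUnits.map ℓ (algebraMap K L) z ∈ pseudoInf ℓ L) : z ∈ pseudoInf ℓ K := by
  rw [mem_pseudoInf_iff] at hz ⊢
  intro v hv
  obtain ⟨w, rfl⟩ := exists_place_over L v
  have hw := (above_under_iff K w).1 hv
  refine isTorsionMod_of_completionUnderMap w hw ?_
  rw [map_completionUnderMap]
  exact hz w hw

theorem extDiv_apply (a : primeToDiv ℓ K) (w : HeightOneSpectrum (𝓞 L)) :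
    (extDiv ℓ K L a).1 w =
      (Ideal.ramificationIdx' (w.under (𝓞 K)).asIdeal w.asIdeal : ℤ_[ℓ]) * a.1 (w.under (𝓞 K)) :=
  rfl

omit [NumberField K] in
theorem apply_eq_zero_of_above (a : primeToDiv ℓ K) {v : HeightOneSpectrum (𝓞 K)}
    (hv : Above ℓ K v) : a.1 v = 0 := by
  by_contra h
  exact (Finsupp.mem_supported _ _).1 a.2 (Finsupp.mem_support_iff.2 h) hv

theorem ord_map_eq_extDiv_iff (a : primeToDiv ℓ K) (z : AdicUnits ℓ K)
    (w : HeightOneSpectrum (𝓞 L)) :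
    ord ℓ w (AdicUnits.map ℓ (algebraMap K L) z) = (extDiv ℓ K L a).1 w ↔
      ord ℓ (w.under (𝓞 K)) z = a.1 (w.under (𝓞 K)) := by
  rw [ord_map, extDiv_apply]
  exact mul_right_inj' (Nat.cast_ne_zero.2 (ramificationIdx_under_ne_zero K w))

/-- Logarithmic valuations are not compatible with extension of divisors above `ℓ`, but `a` vanishes
there. -/
theorem logVal_map_eq_extDiv_iff (a : primeToDiv ℓ K) (z : AdicUnits ℓ K)
    (w : HeightOneSpectrum (𝓞 L)) :
    logVal ℓ w (AdicUnits.map ℓ (algebraMap K L) z) = (extDiv ℓ K L a).1 w ↔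
      logVal ℓ (w.under (𝓞 K)) z = a.1 (w.under (𝓞 K)) := by
  by_cases hw : Above ℓ L w
  · rw [apply_eq_zero_of_above _ hw, apply_eq_zero_of_above _ ((above_under_iff K w).2 hw),
      logVal_map_eq_zero_iff]
  · rw [logVal_of_not_above hw, logVal_of_not_above (mt (above_under_iff K w).1 hw),
      ord_map_eq_extDiv_iff]

theorem mem_logPrincipal_of_logVal_map {a : primeToDiv ℓ K} {z : AdicUnits ℓ K}
    (h : ∀ w : HeightOneSpectrum (𝓞 L),
      logVal ℓ w (AdicUnits.map ℓ (algebraMap K L) z) = (extDiv ℓ K L a).1 w) :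
    a.1 ∈ logPrincipal ℓ K := by
  refine ⟨z, fun v => ?_⟩
  obtain ⟨w, rfl⟩ := exists_place_over L v
  exact ((logVal_map_eq_extDiv_iff a z w).1 (h w)).symm

/-- A pseudo-infinitesimal element has the same logarithmic divisor as its divisor prime to `ℓ`. -/
theorem logVal_eq_of_mem_pseudoInf {b : primeToDiv ℓ L} {α : AdicUnits ℓ L}
    (hα : α ∈ pseudoInf ℓ L) (hb : ∀ w, b.1 w = ord ℓ w α) (w : HeightOneSpectrum (𝓞 L)) :
    logVal ℓ w α = b.1 w := by
  by_cases hw : Above ℓ L w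
  · rw [apply_eq_zero_of_above _ hw, logVal_eq_zero_of_mem_pseudoInf hα hw]
  · rw [logVal_of_not_above hw, hb]

variable [IsGalois K L] {σ : Gal(L/K)} {a : primeToDiv ℓ K} {α : AdicUnits ℓ L}

/-- By the Leopoldt conjecture, `σ α - α` is a root of unity, being a unit which is locally a root
of unity above `ℓ`; it is not `1` unless the class of `a` is already trivial over `K`. -/
theorem exists_rootOfUnity_of_capitulates (hσ : ∀ τ, τ ∈ Subgroup.zpowers σ) (hLeo : Leopoldt ℓ L)
    (ha : a.1 ∉ pseudoInfPrincipal ℓ K) (hα : α ∈ pseudoInf ℓ L)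
    (hord : ∀ w, (extDiv ℓ K L a).1 w = ord ℓ w α) :
    ∃ (ζ : Lˣ) (k : ℕ), ζ ≠ 1 ∧ ζ ^ ℓ ^ k = 1 ∧ galMap ℓ σ α = α + ofUnit ℓ ζ := by
  obtain ⟨ζ, k, hζ, h⟩ := exists_rootOfUnity_of_leopoldt ℓ hLeo
    (sub_mem (galMap_mem_pseudoInf ℓ σ hα) hα) fun w => by
      rw [map_sub, ord_galMap_of_ext ℓ σ a.1 (fun w => (hord w).symm), sub_self]
  rw [sub_eq_iff_eq_add'] at h
  refine ⟨ζ, k, ?_, hζ, h⟩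
  rintro rfl
  have h1 : ofUnit ℓ (1 : Lˣ) = 0 := by rw [ofUnit, ofMul_one, TensorProduct.tmul_zero]
  rw [h1, add_zero] at h
  obtain ⟨z, rfl⟩ := exists_map_of_galMap_eq ℓ hσ h
  refine ha ⟨z, mem_pseudoInf_of_map hα, fun v => ?_⟩
  obtain ⟨w, rfl⟩ := exists_place_over L v
  exact ((ord_map_eq_extDiv_iff a z w).1 (hord w).symm).symm

omit [NumberField K] [NumberField L] [IsGalois K L] in
theorem nsmul_kummer_generator {y : Lˣ} {c : Kˣ} (hy : (y : L) ^ ℓ = algebraMap K L c)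
    (γ : AdicUnits ℓ K) :
    (ℓ : ℤ_[ℓ]) • (ofUnit ℓ y + AdicUnits.map ℓ (algebraMap K L) γ) =
      AdicUnits.map ℓ (algebraMap K L) (ofUnit ℓ c + (ℓ : ℤ_[ℓ]) • γ) := by
  have h : Units.map (algebraMap K L).toMonoidHom c = y ^ ℓ := Units.ext hy.symm
  have h1 : AdicUnits.map ℓ (algebraMap K L) (ofUnit ℓ c) = ℓ • ofUnit ℓ y :=
    (AdicUnits.map_ofUnit ..).trans ((congrArg (ofUnit ℓ) h).trans (ofUnit_pow ..))
  rw [smul_add, map_add, map_smul, h1, Nat.cast_smul_eq_nsmul]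

omit [IsGalois K L] in
/-- If a multiple of a pseudo-infinitesimal element `α` of divisor `a_L` comes from `K`, then `a`
has degree `0`. -/
theorem logDivDeg_eq_zero_of_smul_eq_map (hα : α ∈ pseudoInf ℓ L)
    (hord : ∀ w, (extDiv ℓ K L a).1 w = ord ℓ w α) {ε : AdicUnits ℓ K}
    (hε : (ℓ : ℤ_[ℓ]) • α = AdicUnits.map ℓ (algebraMap K L) ε) : logDivDeg ℓ K a.1 = 0 := by
  have hℓ0 : (ℓ : ℤ_[ℓ]) ≠ 0 := Nat.cast_ne_zero.2 (Fact.out : ℓ.Prime).ne_zero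
  have h1 : normLog ℓ ε = 0 := by
    have h := congrArg (normLog ℓ) hε
    rw [normLog_map, map_smul, normLog_eq_zero_of_mem_pseudoInf ℓ hα, smul_zero, eq_comm,
      mul_eq_zero, Nat.cast_eq_zero] at h
    exact h.resolve_left Module.finrank_pos.ne'
  have h2 : ∀ v, ((ℓ : ℤ_[ℓ]) • a).1 v = ord ℓ v ε := by
    intro v
    obtain ⟨w, rfl⟩ := exists_place_over L v
    refine ((ord_map_eq_extDiv_iff _ ε w).1 ?_).symm
    rw [← hε, map_smul, map_smul, ← hord]
    rfl
  have h3 := logDivDeg_eq_normLog ℓ ((ℓ : ℤ_[ℓ]) • a).2 h2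
  rw [h1, Submodule.coe_smul, map_smul, smul_eq_mul] at h3
  exact (mul_eq_zero.1 h3).resolve_left hℓ0

omit [IsGalois K L] in
/-- If `a` is the logarithmic divisor of `β`, then `ℓ • (α - β)` is a logarithmic unit of `K`
generating the Kummer extension `L`. -/
theorem exists_logUnit_of_mem_logPrincipal (hα : α ∈ pseudoInf ℓ L)
    (hord : ∀ w, (extDiv ℓ K L a).1 w = ord ℓ w α) {y : Lˣ} {c : Kˣ} {γ : AdicUnits ℓ K}
    (hy : (y : L) ^ ℓ = algebraMap K L c) (hy' : IntermediateField.adjoin K {(y : L)} = ⊤)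
    (hγ : α = ofUnit ℓ y + AdicUnits.map ℓ (algebraMap K L) γ) (ha : a.1 ∈ logPrincipal ℓ K) :
    ∃ ε ∈ logUnits ℓ K, IsKummerExt ℓ K L ε := by
  obtain ⟨β, hβ⟩ := ha
  refine ⟨ofUnit ℓ c + (ℓ : ℤ_[ℓ]) • (γ - β), ?_, c, γ - β, rfl, y, hy, hy'⟩
  refine (Submodule.mem_iInf _).2 fun v => ?_
  obtain ⟨w, rfl⟩ := exists_place_over L v
  rw [LinearMap.mem_ker, ← logVal_map_eq_zero_iff, ← nsmul_kummer_generator hy, map_sub,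
    ← add_sub_assoc, ← hγ, map_smul, map_sub, logVal_eq_of_mem_pseudoInf hα hord,
    (logVal_map_eq_extDiv_iff a β w).2 (hβ _).symm, sub_self, smul_zero]

/-- If `L` is generated by an `ℓ`-th root `η` of a logarithmic unit, then some `α - j η` is fixed by
Galois, and has the same logarithmic divisor as `α`. -/
theorem mem_logPrincipal_of_isKummerExt (hσ : ∀ τ, τ ∈ Subgroup.zpowers σ)
    (hdeg : Module.finrank K L = ℓ) (hα : α ∈ pseudoInf ℓ L)
    (hord : ∀ w, (extDiv ℓ K L a).1 w = ord ℓ w α) {ζ : Lˣ} (hζ : (ζ : L) ^ ℓ = 1)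
    (hσα : galMap ℓ σ α = α + ofUnit ℓ ζ) {ε : AdicUnits ℓ K} (hε : ε ∈ logUnits ℓ K)
    (hL : IsKummerExt ℓ K L ε) : a.1 ∈ logPrincipal ℓ K := by
  obtain ⟨x, β, rfl, y₀, hy₀, hy₀'⟩ := hL
  have hℓ0 : (ℓ : ℤ_[ℓ]) ≠ 0 := Nat.cast_ne_zero.2 (Fact.out : ℓ.Prime).ne_zero
  have hyK := not_mem_range_of_adjoin_eq_top hdeg hy₀'
  obtain ⟨y, rfl⟩ : ∃ y : Lˣ, (y : L) = y₀ :=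
    ⟨Units.mk0 _ fun h => hyK ⟨0, by rw [h, map_zero]⟩, rfl⟩
  obtain ⟨j, hj⟩ := exists_pow_eigenvector hσ y.ne_zero ⟨_, hy₀.symm⟩ hyK hζ
  set η := ofUnit ℓ y + AdicUnits.map ℓ (algebraMap K L) β with hη
  have hη0 : ∀ w : HeightOneSpectrum (𝓞 L), logVal ℓ w η = 0 := by
    intro w
    have h : (ℓ : ℤ_[ℓ]) • logVal ℓ w η = 0 := by
      rw [← map_smul, hη, nsmul_kummer_generator hy₀, logVal_map_eq_zero_iff]
      exact (Submodule.mem_iInf _).1 hε _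
    exact (smul_eq_zero.1 h).resolve_left hℓ0
  have hση : galMap ℓ σ (j • η) = j • η + ofUnit ℓ ζ := by
    have h1 : galMap ℓ σ (ofUnit ℓ (y ^ j)) = ofUnit ℓ ζ + ofUnit ℓ (y ^ j) := by
      rw [← ofUnit_mul, AdicUnits.map_ofUnit]
      refine congrArg (ofUnit ℓ) (Units.ext ?_)
      rw [Units.val_mul, Units.val_pow_eq_pow_val]
      exact hj
    rw [hη, nsmul_add, ← ofUnit_pow, map_add, h1, map_nsmul, galMap_map]
    abel
  obtain ⟨δ, hδ⟩ := exists_map_of_galMap_eq ℓ hσ (x := α - j • η) (by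
    rw [map_sub, hσα, hση, add_sub_add_right_eq_sub])
  refine mem_logPrincipal_of_logVal_map (L := L) (z := δ) fun w => ?_
  rw [hδ, map_sub, map_nsmul, hη0, smul_zero, sub_zero, logVal_eq_of_mem_pseudoInf hα hord]

end Capitulation

end
end LogCap


theorem mainTheorem10 (ℓ : ℕ) [Fact ℓ.Prime] (hℓ : ℓ ≠ 2)
    (K L : Type*) [Field K] [NumberField K] [Field L] [NumberField L] [Algebra K L]
    (hμ : ∃ ζ : K, IsPrimitiveRoot ζ ℓ)
    [IsGalois K L] [IsCyclic (L ≃ₐ[K] L)] (hdeg : Module.finrank K L = ℓ)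
    (hcyc : LogCap.LocallyCyclotomic ℓ K L)
    (hLeo : LogCap.Leopoldt ℓ L)
    (a : LogCap.primeToDiv ℓ K)
    (ha : (LogCap.SubQuot.mk _ _ a.1 a.2 : LogCap.BPClass ℓ K) ≠ 0)
    (hcap : (LogCap.SubQuot.mk _ _ (LogCap.extDiv ℓ K L a).1 (LogCap.extDiv ℓ K L a).2 :
      LogCap.BPClass ℓ L) = 0) :
    (LogCap.ClassType ℓ L a ∨ LogCap.UnitType ℓ L a) ∧
    ¬ (LogCap.ClassType ℓ L a ∧ LogCap.UnitType ℓ L a) ∧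
    (LogCap.UnitType ℓ L a ↔
      ∃ ε ∈ LogCap.logUnits ℓ K, LogCap.IsKummerExt ℓ K L ε) := by
  rw [Ne, LogCap.SubQuot.mk_eq_zero_iff] at ha
  obtain ⟨α, hα, hord⟩ := (LogCap.SubQuot.mk_eq_zero_iff _ _ _ _).1 hcap
  obtain ⟨σ, hσ⟩ := ‹IsCyclic (L ≃ₐ[K] L)›
  obtain ⟨ζ, k, hζ1, hζ, hσα⟩ := LogCap.exists_rootOfUnity_of_capitulates hσ hLeo ha hα hord
  obtain ⟨y, c, γ, hy, hy', hγ⟩ := LogCap.exists_kummer_generator hσ hℓ hμ hdeg hζ1 hζ hσα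
  have hunit (h : a.1 ∈ LogCap.logPrincipal ℓ K) : LogCap.UnitType ℓ L a :=
    ⟨h, LogCap.exists_logUnit_of_mem_logPrincipal hα hord hy hy' hγ h⟩
  refine ⟨?_, ?_, fun h => h.2, ?_⟩
  · by_cases h : a.1 ∈ LogCap.logPrincipal ℓ K
    · exact Or.inr (hunit h)
    · refine Or.inl ⟨?_, ?_, ?_, ?_⟩
      · exact LogCap.logDivDeg_eq_zero_of_smul_eq_map hα hord
          (hγ ▸ LogCap.nsmul_kummer_generator hy γ)
      · exact (LogCap.logDivDeg_eq_normLog ℓ (LogCap.extDiv ℓ K L a).2 hord).trans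
          (LogCap.normLog_eq_zero_of_mem_pseudoInf ℓ hα)
      · exact fun h0 => h ((LogCap.SubQuot.mk_eq_zero_iff _ _ _ _).1 h0)
      · exact (LogCap.SubQuot.mk_eq_zero_iff _ _ _ _).2
          ⟨α, fun w => (LogCap.logVal_eq_of_mem_pseudoInf hα hord w).symm⟩
  · rintro ⟨⟨hK, -, hne, -⟩, hprin, -⟩
    exact hne ((LogCap.SubQuot.mk_eq_zero_iff _ _ _ _).2 hprin)
  · rintro ⟨ε, hε, hL⟩
    exact hunit (LogCap.mem_logPrincipal_of_isKummerExt hσ hdeg hα hord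
      (LogCap.rootOfUnity_pow_eq_one hσ hℓ hμ hdeg hζ hσα) hσα hε hL)
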